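/- **Lemma 2.1 (stationary = flat).** Let $G$ be a finite-dimensional real Lie group with Lie algebra $\mathfrak g$, and let $\operatorname{Tr}(XY)=B(X,Y)$ be a symmetric bilinear form on $\mathfrak g$ that is invariant, i.e. $B([X,Y],Z)=-B(Y,[X,Z])$ for all $X,Y,Z\in\mathfrak g$. Let $M$ be a closed (compact, Hausdorff, without boundary) oriented smooth $3$-manifold, and let $\mathcal A=\Omega^1(M)\otimes\mathfrak g$ be the space of connections $d+A$ on the trivial principal $G$-bundle over $M$. For $A=\sum_I\zeta^I\otimes E_I\in\mathcal A$ put $$A\wedge A=\tfrac12\sum_{I,J}(\zeta^I\wedge\zeta^J)\otimes[E_I,E_J],\qquad F=dA+A\wedge A,$$ $$\operatorname{Tr}(A\wedge A\wedge A)=\operatorname{Tr}((A\wedge A)\wedge A)=\tfrac12\sum_{I,J,K}B([E_I,E_J],E_K)\,\zeta^I\wedge\zeta^J\wedge\zeta^K,$$ and let $$S(A)=\frac1{4\pi}\int_M\operatorname{Tr}\bigl(A\wedge dA+\tfrac23A\wedge A\wedge A\bigr)$$ be the Chern–Simons action. Then for every $A\in\mathcal A$ the curvature $F$ of $A$ defines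 a linear functional $\delta A\mapsto\int_M\operatorname{Tr}(\delta A\wedge F)$ on $T_A\mathcal A=\Omega^1(M)\otimes\mathfrak g$, and the first variation of $S$ at $A$ is $\frac1{2\pi}$ times this functional: $$\frac{d}{dt}\Big|_{t=0}S(A+t\,\delta A)=\frac1{2\pi}\int_M\operatorname{Tr}(\delta A\wedge F)\qquad\text{for all }\delta A\in\Omega^1(M)\otimes\mathfrak g .$$ If moreover $B$ is nondegenerate, then the stationary points of $S$ (the $A$ at which the first variation vanishes for all $\delta A$) are exactly the flat connections, i.e. those with $F=0$. -/

import Mathlib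

open scoped Manifold ContDiff TensorProduct Nat
open Set

noncomputable section

/-! ### The wedge product of alternating forms on a vector space -/

/-- The tensor product `α ⊗ β` of two alternating forms, as a multilinear form. -/
def altTensor {E : Type*} [AddCommGroup E] [Module ℝ E] [TopologicalSpace E] {k l : ℕ}
    (α : E [⋀^Fin k]→L[ℝ] ℝ) (β : E [⋀^Fin l]→L[ℝ] ℝ) :
    ContinuousMultilinearMap ℝ (fun _ : Fin (k + l) => E) ℝ :=
  { (LinearMap.mul' ℝ ℝ).compMultilinearMap
      ((MultilinearMap.domCoprod α.toMultilinearMap β.toMultilinearMap).domDomCongr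
        finSumFinEquiv) with
    cont := by
      have h : Continuous fun v : Fin (k + l) → E =>
          α (fun i => v (Fin.castAdd l i)) * β (fun j => v (Fin.natAdd k j)) :=
        (α.cont.comp (continuous_pi fun i => continuous_apply _)).mul
          (β.cont.comp (continuous_pi fun i => continuous_apply _))
      exact h }

theorem altTensor_apply {E : Type*} [AddCommGroup E] [Module ℝ E] [TopologicalSpace E] {k l : ℕ}
    (α : E [⋀^Fin k]→L[ℝ] ℝ) (β : E [⋀^Fin l]→L[ℝ] ℝ) (v : Fin (k + l) → E) :
    altTensor α β v =
      α (fun i => v (Fin.castAdd l i)) * β (fun j => v (Fin.natAdd k j)) := rfl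

/-- The wedge product
`(α ∧ β)(v₁, …, v_{k+l}) = 1/(k! l!) ∑_σ sign σ · α(v_{σ 1}, …, v_{σ k}) β(v_{σ(k+1)}, …, v_{σ(k+l)})`. -/
def altWedge {E : Type*} [AddCommGroup E] [Module ℝ E] [TopologicalSpace E] {k l : ℕ}
    (α : E [⋀^Fin k]→L[ℝ] ℝ) (β : E [⋀^Fin l]→L[ℝ] ℝ) : E [⋀^Fin (k + l)]→L[ℝ] ℝ :=
  ((k ! * l ! : ℝ)⁻¹) • ContinuousMultilinearMap.alternatization (altTensor α β)

theorem altWedge_apply {E : Type*} [AddCommGroup E] [Module ℝ E] [TopologicalSpace E] {k l : ℕ}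
    (α : E [⋀^Fin k]→L[ℝ] ℝ) (β : E [⋀^Fin l]→L[ℝ] ℝ) (v : Fin (k + l) → E) :
    altWedge α β v = (k ! * l ! : ℝ)⁻¹ * ∑ σ : Equiv.Perm (Fin (k + l)),
      (Equiv.Perm.sign σ : ℝ) *
        (α (fun i => v (σ (Fin.castAdd l i))) * β (fun j => v (σ (Fin.natAdd k j)))) := by
  simp [altWedge, ContinuousMultilinearMap.alternatization_apply_apply, altTensor_apply,
    Units.smul_def]

/-- The wedge product as a bilinear map. -/
def altWedgeₗ (E : Type*) [AddCommGroup E] [Module ℝ E] [TopologicalSpace E] (k l : ℕ) :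
    (E [⋀^Fin k]→L[ℝ] ℝ) →ₗ[ℝ] (E [⋀^Fin l]→L[ℝ] ℝ) →ₗ[ℝ] (E [⋀^Fin (k + l)]→L[ℝ] ℝ) :=
  LinearMap.mk₂ ℝ altWedge
    (fun a b c => by
      ext v
      simp only [altWedge_apply, ContinuousAlternatingMap.add_apply, ← mul_add,
        ← Finset.sum_add_distrib, add_mul])
    (fun r a c => by
      ext v
      simp only [altWedge_apply, ContinuousAlternatingMap.smul_apply, smul_eq_mul, Finset.mul_sum]
      exact Finset.sum_congr rfl fun σ _ => by ring)
    (fun a b c => by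
      ext v
      simp only [altWedge_apply, ContinuousAlternatingMap.add_apply, ← mul_add,
        ← Finset.sum_add_distrib])
    (fun r a c => by
      ext v
      simp only [altWedge_apply, ContinuousAlternatingMap.smul_apply, smul_eq_mul, Finset.mul_sum]
      exact Finset.sum_congr rfl fun σ _ => by ring)

theorem altWedge_comp {E E' : Type*} [AddCommGroup E] [Module ℝ E] [TopologicalSpace E]
    [AddCommGroup E'] [Module ℝ E'] [TopologicalSpace E'] {k l : ℕ}
    (α : E [⋀^Fin k]→L[ℝ] ℝ) (β : E [⋀^Fin l]→L[ℝ] ℝ) (L : E' →L[ℝ] E) :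
    (altWedge α β).compContinuousLinearMap L =
      altWedge (α.compContinuousLinearMap L) (β.compContinuousLinearMap L) := by
  ext v
  simp [altWedge_apply, Function.comp_def]

theorem finiteDimensional_alt (E : Type*) [NormedAddCommGroup E] [NormedSpace ℝ E]
    [FiniteDimensional ℝ E] (k : ℕ) : FiniteDimensional ℝ (E [⋀^Fin k]→L[ℝ] ℝ) :=
  Module.Finite.of_injective
    ({ toFun := fun α => α.toMultilinearMap
       map_add' := fun _ _ => rfl
       map_smul' := fun _ _ => rfl } :
      (E [⋀^Fin k]→L[ℝ] ℝ) →ₗ[ℝ] MultilinearMap ℝ (fun _ : Fin k => E) ℝ)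
    (fun α β h => by
      ext v
      exact congrArg (fun f : MultilinearMap ℝ (fun _ : Fin k => E) ℝ => f v) h)

theorem contDiffOn_altWedge {E : Type*} [NormedAddCommGroup E] [NormedSpace ℝ E]
    [FiniteDimensional ℝ E] {k l : ℕ} {α : E → E [⋀^Fin k]→L[ℝ] ℝ}
    {β : E → E [⋀^Fin l]→L[ℝ] ℝ} {s : Set E} (hα : ContDiffOn ℝ ∞ α s)
    (hβ : ContDiffOn ℝ ∞ β s) : ContDiffOn ℝ ∞ (fun y => altWedge (α y) (β y)) s := by
  have := finiteDimensional_alt E k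
  have := finiteDimensional_alt E l
  let W := (altWedgeₗ E k l).toContinuousBilinearMap
  exact (W.contDiff.comp_contDiffOn hα).clm_apply hβ

/-! ### Differential forms on a manifold -/

/-- Not necessarily smooth `k`-forms on the `n`-manifold `M`. -/
abbrev RawForm (n : ℕ) (M : Type*) [TopologicalSpace M] [ChartedSpace (EuclideanSpace ℝ (Fin n)) M]
    (k : ℕ) : Type _ :=
  (x : M) → TangentSpace (𝓡 n) x [⋀^Fin k]→L[ℝ] ℝ

section Manifold
variable {n : ℕ} {M : Type*} [TopologicalSpace M] [ChartedSpace (EuclideanSpace ℝ (Fin n)) M]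
  {k l : ℕ}

/-- The derivative at `y` of the inverse of the chart at `c`, `ℝⁿ → T_{φ⁻¹(y)} M`. -/
def chartPush (c : M) (y : EuclideanSpace ℝ (Fin n)) :
    EuclideanSpace ℝ (Fin n) →L[ℝ]
      TangentSpace (𝓡 n) ((chartAt (EuclideanSpace ℝ (Fin n)) c).symm y) :=
  (mfderiv (𝓡 n) (𝓡 n) (chartAt (EuclideanSpace ℝ (Fin n)) c).symm y).comp
    (NormedSpace.fromTangentSpace y).symm.toContinuousLinearMap

/-- The derivative at `x` of the chart at `x`, `T_x M → ℝⁿ`. -/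
def chartDeriv (x : M) : TangentSpace (𝓡 n) x →L[ℝ] EuclideanSpace ℝ (Fin n) :=
  (NormedSpace.fromTangentSpace
      (chartAt (EuclideanSpace ℝ (Fin n)) x x)).toContinuousLinearMap.comp
    (mfderiv (𝓡 n) (𝓡 n) (chartAt (EuclideanSpace ℝ (Fin n)) x) x)

/-- The expression of a form in the chart at `c`: its pullback by the inverse of the chart. -/
def localRep (η : RawForm n M k) (c : M) (y : EuclideanSpace ℝ (Fin n)) :
    EuclideanSpace ℝ (Fin n) [⋀^Fin k]→L[ℝ] ℝ :=
  (η ((chartAt (EuclideanSpace ℝ (Fin n)) c).symm y)).compContinuousLinearMap (chartPush c y)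

variable (n M k) in
/-- The subspace of smooth `k`-forms: those that are smooth in every chart. -/
def smoothForms : Submodule ℝ (RawForm n M k) where
  carrier := {η | ∀ c : M,
    ContDiffOn ℝ ∞ (localRep η c) (chartAt (EuclideanSpace ℝ (Fin n)) c).target}
  add_mem' ha hb c := (ha c).add (hb c)
  zero_mem' _ := contDiffOn_const (c := 0)
  smul_mem' r _ ha c := (ha c).const_smul r

/-- The exterior derivative, computed at `x` in the chart at `x`. By `localRep_rawExtDeriv` it is
given by the exterior derivative on `ℝⁿ` in every other chart as well. -/
def rawExtDeriv (η : RawForm n M k) : RawForm n M (k + 1) := fun x =>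
  (extDeriv (localRep η x) (chartAt (EuclideanSpace ℝ (Fin n)) x x)).compContinuousLinearMap
    (chartDeriv x)

theorem localRep_comp_mfderiv [IsManifold (𝓡 n) ∞ M] (η : RawForm n M k) (c : M) {p : M}
    (hp : p ∈ (chartAt (EuclideanSpace ℝ (Fin n)) c).source)
    (v : Fin k → TangentSpace (𝓡 n) p) :
    localRep η c (chartAt (EuclideanSpace ℝ (Fin n)) c p)
      (fun i => mfderiv (𝓡 n) (𝓡 n) (chartAt (EuclideanSpace ℝ (Fin n)) c) p (v i)) = η p v := by
  have key : ∀ q : M, q = p → ∀ (w : Fin k → TangentSpace (𝓡 n) q),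
      (∀ i, (w i : EuclideanSpace ℝ (Fin n)) = v i) → η q w = η p v := by
    rintro q rfl w hw
    congr 1
    funext i
    exact hw i
  refine key _ ((chartAt (EuclideanSpace ℝ (Fin n)) c).left_inv hp) _ fun i => ?_
  have h1 := mdifferentiableAt_atlas (I := 𝓡 n) (chart_mem_atlas (EuclideanSpace ℝ (Fin n)) c) hp
  have h2 := mdifferentiableAt_atlas_symm (I := 𝓡 n)
    (chart_mem_atlas (EuclideanSpace ℝ (Fin n)) c)
    ((chartAt (EuclideanSpace ℝ (Fin n)) c).map_source hp)
  have h3 := mfderiv_comp p h2 h1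
  have h4 : (chartAt (EuclideanSpace ℝ (Fin n)) c).symm ∘ (chartAt (EuclideanSpace ℝ (Fin n)) c)
      =ᶠ[nhds p] id := by
    filter_upwards [(chartAt (EuclideanSpace ℝ (Fin n)) c).open_source.mem_nhds hp] with q hq
    exact (chartAt (EuclideanSpace ℝ (Fin n)) c).left_inv hq
  have h5 := h4.mfderiv_eq (I := 𝓡 n) (I' := 𝓡 n)
  rw [h3, mfderiv_id] at h5
  exact DFunLike.congr_fun h5 (v i)

theorem localRep_transition [IsManifold (𝓡 n) ∞ M] (η : RawForm n M k) (c d : M)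
    {z : EuclideanSpace ℝ (Fin n)} (hz : z ∈ (chartAt (EuclideanSpace ℝ (Fin n)) c).target)
    (hzd : (chartAt (EuclideanSpace ℝ (Fin n)) c).symm z ∈
      (chartAt (EuclideanSpace ℝ (Fin n)) d).source) :
    localRep η c z =
      (localRep η d ((chartAt (EuclideanSpace ℝ (Fin n)) d)
        ((chartAt (EuclideanSpace ℝ (Fin n)) c).symm z))).compContinuousLinearMap
        (fderiv ℝ ((chartAt (EuclideanSpace ℝ (Fin n)) d) ∘
          (chartAt (EuclideanSpace ℝ (Fin n)) c).symm) z) := by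
  ext v
  have h1 := mdifferentiableAt_atlas (I := 𝓡 n) (chart_mem_atlas (EuclideanSpace ℝ (Fin n)) d) hzd
  have h2 := mdifferentiableAt_atlas_symm (I := 𝓡 n)
    (chart_mem_atlas (EuclideanSpace ℝ (Fin n)) c) hz
  have h3 := mfderiv_comp z h1 h2
  rw [mfderiv_eq_fderiv] at h3
  have h4 := localRep_comp_mfderiv η d hzd (fun i => chartPush c z (v i))
  refine Eq.trans h4.symm ?_
  refine congrArg (localRep η d _) (funext fun i => ?_)
  exact (DFunLike.congr_fun h3 (v i)).symm

theorem contDiffAt_transition [IsManifold (𝓡 n) ∞ M] (c d : M)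
    {z : EuclideanSpace ℝ (Fin n)} (hz : z ∈ (chartAt (EuclideanSpace ℝ (Fin n)) c).target)
    (hzd : (chartAt (EuclideanSpace ℝ (Fin n)) c).symm z ∈
      (chartAt (EuclideanSpace ℝ (Fin n)) d).source) :
    ContDiffAt ℝ ∞ ((chartAt (EuclideanSpace ℝ (Fin n)) d) ∘
          (chartAt (EuclideanSpace ℝ (Fin n)) c).symm) z := by
  rw [← contMDiffAt_iff_contDiffAt]
  refine ContMDiffAt.comp z (I' := 𝓡 n) ?_ ?_
  · exact contMDiffOn_chart.contMDiffAt
      ((chartAt (EuclideanSpace ℝ (Fin n)) d).open_source.mem_nhds hzd)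
  · exact contMDiffOn_chart_symm.contMDiffAt
      ((chartAt (EuclideanSpace ℝ (Fin n)) c).open_target.mem_nhds hz)

theorem localRep_rawExtDeriv [IsManifold (𝓡 n) ∞ M] {η : RawForm n M k} (hη : η ∈ smoothForms n M k)
    (c : M) {y : EuclideanSpace ℝ (Fin n)}
    (hy : y ∈ (chartAt (EuclideanSpace ℝ (Fin n)) c).target) :
    localRep (rawExtDeriv η) c y = extDeriv (localRep η c) y := by
  set e := chartAt (EuclideanSpace ℝ (Fin n)) c with he
  set d : M := e.symm y with hd
  set f := chartAt (EuclideanSpace ℝ (Fin n)) d with hf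
  have hyd : e.symm y ∈ f.source := mem_chart_source (EuclideanSpace ℝ (Fin n)) d
  have hev : localRep η c =ᶠ[nhds y] fun z =>
      (localRep η d ((f ∘ e.symm) z)).compContinuousLinearMap (fderiv ℝ (f ∘ e.symm) z) := by
    filter_upwards [(e.isOpen_inter_preimage_symm f.open_source).mem_nhds ⟨hy, hyd⟩] with z hz
    exact localRep_transition η c d hz.1 hz.2
  have hdiff : DifferentiableAt ℝ (localRep η d) ((f ∘ e.symm) y) :=
    ((hη d).contDiffAt (f.open_target.mem_nhds (f.map_source hyd))).differentiableAt (by simp)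
  rw [hev.extDeriv_eq, extDeriv_pullback hdiff (contDiffAt_transition c d hy hyd)
    (by rw [minSmoothness_of_isRCLikeNormedField]; exact ENat.LEInfty.out)]
  ext v
  have h1 := mdifferentiableAt_atlas (I := 𝓡 n) (chart_mem_atlas (EuclideanSpace ℝ (Fin n)) d) hyd
  have h2 := mdifferentiableAt_atlas_symm (I := 𝓡 n)
    (chart_mem_atlas (EuclideanSpace ℝ (Fin n)) c) hy
  have h3 := mfderiv_comp y h1 h2
  rw [mfderiv_eq_fderiv] at h3
  refine congrArg (extDeriv (localRep η d) _) (funext fun i => ?_)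
  exact (DFunLike.congr_fun h3 (v i)).symm

theorem rawExtDeriv_mem [IsManifold (𝓡 n) ∞ M] {η : RawForm n M k} (hη : η ∈ smoothForms n M k) :
    rawExtDeriv η ∈ smoothForms n M (k + 1) := by
  intro c
  refine ContDiffOn.congr ?_ fun y hy => localRep_rawExtDeriv hη c hy
  exact (ContinuousAlternatingMap.alternatizeUncurryFinCLM ℝ (EuclideanSpace ℝ (Fin n))
    ℝ).contDiff.comp_contDiffOn
      ((hη c).fderiv_of_isOpen (chartAt (EuclideanSpace ℝ (Fin n)) c).open_target
        (m := ∞) (by exact le_rfl))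

variable (n M k) in
/-- The real vector space `Ωᵏ(M)` of smooth real `k`-forms on `M`. -/
def DiffForm : Type _ := smoothForms n M k

instance : AddCommGroup (DiffForm n M k) := inferInstanceAs (AddCommGroup (smoothForms n M k))

instance : Module ℝ (DiffForm n M k) := inferInstanceAs (Module ℝ (smoothForms n M k))

theorem differentiableAt_localRep (η : DiffForm n M k) (x : M) :
    DifferentiableAt ℝ (localRep η.1 x)
      (chartAt (EuclideanSpace ℝ (Fin n)) x x) :=
  ((η.2 x).contDiffAt ((chartAt (EuclideanSpace ℝ (Fin n)) x).open_target.mem_nhds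
    (mem_chart_target (EuclideanSpace ℝ (Fin n)) x))).differentiableAt (by simp)

variable (n M k) in
/-- The exterior derivative `d : Ωᵏ(M) → Ωᵏ⁺¹(M)`. -/
def dForm [IsManifold (𝓡 n) ∞ M] : DiffForm n M k →ₗ[ℝ] DiffForm n M (k + 1) where
  toFun η := ⟨rawExtDeriv η.1, rawExtDeriv_mem η.2⟩
  map_add' a b := by
    refine Subtype.ext (funext fun x => ?_)
    exact congrArg (fun L => ContinuousAlternatingMap.compContinuousLinearMap L (chartDeriv x))
      (extDeriv_add (differentiableAt_localRep a x) (differentiableAt_localRep b x))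
  map_smul' r a := by
    refine Subtype.ext (funext fun x => ?_)
    exact congrArg (fun L => ContinuousAlternatingMap.compContinuousLinearMap L (chartDeriv x))
      (extDeriv_smul r (localRep a.1 x))

theorem rawWedge_mem [IsManifold (𝓡 n) ∞ M] (a : DiffForm n M k) (b : DiffForm n M l) :
    (fun x => altWedge (a.1 x) (b.1 x) : RawForm n M (k + l)) ∈ smoothForms n M (k + l) := by
  intro c
  refine ContDiffOn.congr (contDiffOn_altWedge (a.2 c) (b.2 c)) fun y hy => ?_
  exact altWedge_comp _ _ _

variable (n M k l) in
/-- The wedge product `Ωᵏ(M) × Ωˡ(M) → Ωᵏ⁺ˡ(M)`. -/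
def wedge [IsManifold (𝓡 n) ∞ M] :
    DiffForm n M k →ₗ[ℝ] DiffForm n M l →ₗ[ℝ] DiffForm n M (k + l) :=
  LinearMap.mk₂ ℝ (fun a b => ⟨fun x => altWedge (a.1 x) (b.1 x), rawWedge_mem a b⟩)
    (fun _ _ _ => Subtype.ext (funext fun _ => (altWedgeₗ _ k l).map_add₂ _ _ _))
    (fun _ _ _ => Subtype.ext (funext fun _ => (altWedgeₗ _ k l).map_smul₂ _ _ _))
    (fun _ _ _ => Subtype.ext (funext fun _ => ((altWedgeₗ _ k l) _).map_add _ _))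
    (fun _ _ _ => Subtype.ext (funext fun _ => ((altWedgeₗ _ k l) _).map_smul _ _))

/-! ### Integration over a closed oriented manifold -/

variable (n M) in
/-- An orientation of `M`, presented by a nowhere vanishing smooth top-degree form: a frame is
positively oriented when the form takes a positive value on it. -/
structure OrientationForm where
  form : DiffForm n M n
  ne_zero : ∀ x : M, form.1 x ≠ 0

/-- The coefficient of `dy¹ ∧ ⋯ ∧ dyⁿ` of a top-degree form in the chart at `c`. -/
def topCoeff (η : DiffForm n M n) (c : M) (y : EuclideanSpace ℝ (Fin n)) : ℝ :=
  localRep η.1 c y (EuclideanSpace.basisFun (Fin n) ℝ)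

variable (n M) in
/-- A smooth partition of unity of the closed manifold `M`, the function with index `c` being
supported in the domain of the chart at `c`. -/
def chartPartition [IsManifold (𝓡 n) ∞ M] [T2Space M] [CompactSpace M] :
    SmoothPartitionOfUnity M (𝓡 n) M univ :=
  (SmoothPartitionOfUnity.exists_isSubordinate_chartAt_source (𝓡 n) M).choose

/-- The integral of a top-degree form over the closed oriented manifold `(M, o)`: the form is cut
into pieces by a partition of unity subordinate to the charts, and each piece is integrated in its
chart against Lebesgue measure, with sign `+1` or `-1` according to whether the chart preserves or
reverses the orientation. Only finitely many pieces are nonzero. -/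
def integral [IsManifold (𝓡 n) ∞ M] [T2Space M] [CompactSpace M] (o : OrientationForm n M)
    (η : DiffForm n M n) : ℝ :=
  ∑ᶠ c : M, ∫ y in (chartAt (EuclideanSpace ℝ (Fin n)) c).target,
    Real.sign (topCoeff o.form c y) *
      (chartPartition n M c ((chartAt (EuclideanSpace ℝ (Fin n)) c).symm y) * topCoeff η c y)

end Manifold

/-! ### Forms with values in a vector space or Lie algebra -/

section Valued
variable {n : ℕ} {M : Type*} [TopologicalSpace M] [ChartedSpace (EuclideanSpace ℝ (Fin n)) M]
  [IsManifold (𝓡 n) ∞ M] {k l : ℕ}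

variable (n M k) in
/-- The space `Ωᵏ(M) ⊗ V` of `V`-valued smooth `k`-forms. -/
abbrev ValuedForm (V : Type*) [AddCommGroup V] [Module ℝ V] : Type _ := DiffForm n M k ⊗[ℝ] V

/-- The exterior derivative of `V`-valued forms, `d(ζ ⊗ X) = dζ ⊗ X`. -/
def dValued {V : Type*} [AddCommGroup V] [Module ℝ V] :
    ValuedForm n M k V →ₗ[ℝ] ValuedForm n M (k + 1) V :=
  (dForm n M k).rTensor V

/-- The wedge product of vector-valued forms with respect to a bilinear map `f`,
`(ζ ⊗ X) ∧ (ξ ⊗ Y) = (ζ ∧ ξ) ⊗ f X Y`. -/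
def wedgeWith {V W U : Type*} [AddCommGroup V] [Module ℝ V] [AddCommGroup W] [Module ℝ W]
    [AddCommGroup U] [Module ℝ U] (f : V →ₗ[ℝ] W →ₗ[ℝ] U) :
    ValuedForm n M k V →ₗ[ℝ] ValuedForm n M l W →ₗ[ℝ] ValuedForm n M (k + l) U :=
  TensorProduct.map₂ (wedge n M k l) f

variable {L : Type*} [LieRing L] [LieAlgebra ℝ L]

/-- The real-valued form `Tr(α ∧ β)`, where `Tr(XY)` means `B X Y`:
`Tr((ζ ⊗ X) ∧ (ξ ⊗ Y)) = B X Y • ζ ∧ ξ`. -/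
def trWedge (B : LinearMap.BilinForm ℝ L) (α : ValuedForm n M k L) (β : ValuedForm n M l L) :
    DiffForm n M (k + l) :=
  TensorProduct.rid ℝ (DiffForm n M (k + l)) (wedgeWith B α β)

variable (n M L) in
/-- The space `𝒜` of connections `d + A` on the trivial bundle, with `A ∈ Ω¹(M) ⊗ L`. -/
abbrev Connection : Type _ := ValuedForm n M 1 L

/-- The Lie algebra valued two-form `A ∧ A`. For `A = ∑ ζ^I E_I` it is
`∑ ζ^I ∧ ζ^J E_I E_J = 1/2 ∑ ζ^I ∧ ζ^J [E_I, E_J]`, which makes sense in any Lie algebra. -/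
def wedgeSelf (A : Connection n M L) : ValuedForm n M 2 L :=
  (1 / 2 : ℝ) • wedgeWith (LieModule.toEnd ℝ L L : L →ₗ[ℝ] L →ₗ[ℝ] L) A A

/-- The curvature `F = dA + A ∧ A` of the connection `d + A`. -/
def curvature (A : Connection n M L) : ValuedForm n M 2 L :=
  dValued A + wedgeSelf A

/-- The functional `S` on the space of connections has the derivative (first variation) `D` at `A`:
`D` is a linear functional on `T_A 𝒜 = Ω¹(M) ⊗ L`, and for every variation `δA` the function
`t ↦ S (A + t δA)` has the derivative `D δA` at `t = 0`. -/
def HasFirstVariation (S : Connection n M L → ℝ) (D : Connection n M L → ℝ)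
    (A : Connection n M L) : Prop :=
  IsLinearMap ℝ D ∧ ∀ δA : Connection n M L, HasLineDerivAt ℝ S (D δA) A δA

/-- `A` is a stationary point of `S` if the first variation of `S` at `A` exists and is zero. -/
def IsStationaryPoint (S : Connection n M L → ℝ) (A : Connection n M L) : Prop :=
  HasFirstVariation S (fun _ => 0) A

/-- A connection is flat if its curvature vanishes. -/
def IsFlat (A : Connection n M L) : Prop := curvature A = 0

end Valued

/-! ### The Chern-Simons action on a closed oriented three-manifold -/

section ChernSimons
variable {M : Type*} [TopologicalSpace M] [ChartedSpace (EuclideanSpace ℝ (Fin 3)) M]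
  [IsManifold (𝓡 3) ∞ M] {L : Type*} [LieRing L] [LieAlgebra ℝ L]

/-- The Chern-Simons three-form `Tr(A ∧ dA + 2/3 A ∧ A ∧ A)`. -/
def csForm (B : LinearMap.BilinForm ℝ L) (A : Connection 3 M L) : DiffForm 3 M 3 :=
  trWedge (k := 1) (l := 2) B A (dValued A) +
    (2 / 3 : ℝ) • trWedge (k := 2) (l := 1) B (wedgeSelf A) A

variable [T2Space M] [CompactSpace M]

/-- The Chern-Simons action `S(A) = 1/(4π) ∫_M Tr(A ∧ dA + 2/3 A ∧ A ∧ A)`. -/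
def csAction (o : OrientationForm 3 M) (B : LinearMap.BilinForm ℝ L) (A : Connection 3 M L) : ℝ :=
  1 / (4 * Real.pi) * integral o (csForm B A)

/-- The curvature of `A` as a one-form on the affine space of connections: its value at `A` on the
tangent vector `δA ∈ T_A 𝒜 = Ω¹(M) ⊗ L` is `∫_M Tr(δA ∧ F)`. -/
def curvatureOneForm (o : OrientationForm 3 M) (B : LinearMap.BilinForm ℝ L)
    (A δA : Connection 3 M L) : ℝ :=
  integral o (trWedge (k := 1) (l := 2) B δA (curvature A))

end ChernSimons

/-- A smooth real Lie group has the finite order of smoothness that Mathlib asks for in order to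
define its Lie algebra. -/
instance lieGroup_minSmoothness {EG G : Type*} [NormedAddCommGroup EG] [NormedSpace ℝ EG]
    [Group G] [TopologicalSpace G] [ChartedSpace EG G] [LieGroup 𝓘(ℝ, EG) ∞ G] :
    LieGroup 𝓘(ℝ, EG) (minSmoothness ℝ 3) G :=
  LieGroup.of_le (n := ∞)
    (by rw [minSmoothness_of_isRCLikeNormedField]; exact ENat.LEInfty.out)

end

/-! Put Q(a, b) = ∫ Tr(a ∧ db) and T(a, b, c) = ∫ Tr([a ∧ b] ∧ c). Since A ∧ A = ½[A ∧ A], the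
action is S(A) = 1/(4π) (Q(A, A) + ⅓ T(A, A, A)) (`csAction_eq`). Both Q and T are symmetric. For Q
this is integration by parts: d(a ∧ b) = da ∧ b − a ∧ db integrates to zero on a closed manifold,
and B is symmetric (`pairOneTwo_dValued_comm`). For T the sign from the wedge cancels the sign from
the bracket in the first two slots and, by invariance of B, in the last two (`cubicForm_swap_left`,
`cubicForm_swap_right`). Hence S(A + t δA) is a cubic polynomial in t with linear coefficient 1/(4π)
(2 Q(δA, A) + T(A, A, δA)) = 1/(2π) ∫ Tr(δA ∧ F).

That stationary points are flat needs the pairing of one-forms with two-forms to be nondegenerate. A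
basis dual with respect to B reduces this to scalar forms, where a bump function turns a nonzero
two-form into a test form with strictly positive integral
(`eq_zero_of_forall_integral_wedge_eq_zero`).

The analytic input is Stokes' theorem (`integral_dForm`) for the integral defined by a partition of
unity. It rests on two facts: a form supported in one chart may be integrated in that chart
(`integral_eq_setIntegral`, by change of variables), and exact forms with compactly supported
primitive on ℝⁿ have integral zero (`integral_extDeriv_apply_eq_zero`). -/

set_option linter.unusedSectionVars false

/-! ### Coefficients of top-degree forms in charts, and the sign of a chart -/

section ChartIntegrals
variable {n : ℕ} {M : Type*} [TopologicalSpace M] [ChartedSpace (EuclideanSpace ℝ (Fin n)) M]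
  {k : ℕ}

theorem DiffForm.ext_apply {η ζ : DiffForm n M k} (h : ∀ x, η.1 x = ζ.1 x) : η = ζ :=
  Subtype.ext (funext h)

theorem contDiffOn_topCoeff (η : DiffForm n M n) (c : M) :
    ContDiffOn ℝ ∞ (topCoeff η c) (chartAt (EuclideanSpace ℝ (Fin n)) c).target :=
  (ContinuousAlternatingMap.apply ℝ (EuclideanSpace ℝ (Fin n)) ℝ
    (EuclideanSpace.basisFun (Fin n) ℝ)).contDiff.comp_contDiffOn (η.2 c)

/-- Top-degree alternating forms are multiples of the determinant, which is multiplicative. This is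
the source of the Jacobian in a change of charts. -/
theorem ContinuousAlternatingMap.map_comp_eq_det_mul (f : EuclideanSpace ℝ (Fin n) [⋀^Fin n]→L[ℝ] ℝ)
    (A : EuclideanSpace ℝ (Fin n) →L[ℝ] EuclideanSpace ℝ (Fin n)) :
    f.compContinuousLinearMap A (EuclideanSpace.basisFun (Fin n) ℝ) =
      A.det * f (EuclideanSpace.basisFun (Fin n) ℝ) := by
  have h1 := AlternatingMap.eq_smul_basis_det (EuclideanSpace.basisFun (Fin n) ℝ).toBasis
    f.toAlternatingMap
  have h2 := (EuclideanSpace.basisFun (Fin n) ℝ).toBasis.det_comp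
    (A : EuclideanSpace ℝ (Fin n) →ₗ[ℝ] EuclideanSpace ℝ (Fin n))
    (EuclideanSpace.basisFun (Fin n) ℝ).toBasis
  have h3 := congrArg (fun g : EuclideanSpace ℝ (Fin n) [⋀^Fin n]→ₗ[ℝ] ℝ =>
    g (A ∘ (EuclideanSpace.basisFun (Fin n) ℝ).toBasis)) h1
  simp only [AlternatingMap.smul_apply] at h3
  erw [h2] at h3
  rw [Module.Basis.det_self, mul_one, smul_eq_mul, mul_comm] at h3
  simpa [OrthonormalBasis.coe_toBasis] using! h3

theorem ContinuousAlternatingMap.map_basisFun_ne_zero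
    {f : EuclideanSpace ℝ (Fin n) [⋀^Fin n]→L[ℝ] ℝ} (hf : f ≠ 0) :
    f (EuclideanSpace.basisFun (Fin n) ℝ) ≠ 0 := by
  have := (AlternatingMap.map_basis_ne_zero_iff (EuclideanSpace.basisFun (Fin n) ℝ).toBasis
    f.toAlternatingMap).2 fun h => hf (ContinuousAlternatingMap.toAlternatingMap_injective h)
  simpa using! this

theorem localRep_eq_zero {η : RawForm n M k} (c : M) {y : EuclideanSpace ℝ (Fin n)}
    (h : η ((chartAt (EuclideanSpace ℝ (Fin n)) c).symm y) = 0) : localRep η c y = 0 := by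
  rw [localRep, h]
  rfl

theorem topCoeff_eq_zero {η : DiffForm n M n} (c : M) {y : EuclideanSpace ℝ (Fin n)}
    (h : η.1 ((chartAt (EuclideanSpace ℝ (Fin n)) c).symm y) = 0) : topCoeff η c y = 0 := by
  rw [topCoeff, localRep_eq_zero c h]
  rfl

theorem topCoeff_add (η ζ : DiffForm n M n) (c : M) (y : EuclideanSpace ℝ (Fin n)) :
    topCoeff (η + ζ) c y = topCoeff η c y + topCoeff ζ c y := rfl

theorem topCoeff_smul (r : ℝ) (η : DiffForm n M n) (c : M) (y : EuclideanSpace ℝ (Fin n)) :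
    topCoeff (r • η) c y = r * topCoeff η c y := rfl

variable [IsManifold (𝓡 n) ∞ M]

theorem eq_zero_of_localRep_eq_zero {η : RawForm n M k} (c : M) {y : EuclideanSpace ℝ (Fin n)}
    (hy : y ∈ (chartAt (EuclideanSpace ℝ (Fin n)) c).target) (h : localRep η c y = 0) :
    η ((chartAt (EuclideanSpace ℝ (Fin n)) c).symm y) = 0 := by
  ext v
  have h1 := localRep_comp_mfderiv η c
    ((chartAt (EuclideanSpace ℝ (Fin n)) c).map_target hy) v
  rw [(chartAt (EuclideanSpace ℝ (Fin n)) c).right_inv hy, h] at h1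
  exact h1.symm

theorem topCoeff_ne_zero (o : OrientationForm n M) (c : M) {y : EuclideanSpace ℝ (Fin n)}
    (hy : y ∈ (chartAt (EuclideanSpace ℝ (Fin n)) c).target) : topCoeff o.form c y ≠ 0 :=
  ContinuousAlternatingMap.map_basisFun_ne_zero fun h =>
    o.ne_zero _ (eq_zero_of_localRep_eq_zero c hy h)

theorem eventually_sign_eq {X : Type*} [TopologicalSpace X] {f : X → ℝ} {x : X}
    (hf : ContinuousAt f x) (hx : f x ≠ 0) :
    ∀ᶠ z in nhds x, Real.sign (f z) = Real.sign (f x) := by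
  rcases hx.lt_or_gt with h | h
  · filter_upwards [hf.eventually_lt_const h] with z hz
    rw [Real.sign_of_neg h, Real.sign_of_neg hz]
  · filter_upwards [hf.eventually_const_lt h] with z hz
    rw [Real.sign_of_pos h, Real.sign_of_pos hz]

/-- The orientation coefficient is continuous and nowhere zero. Local constancy of its sign is what
lets the sign pass through smoothness arguments and through d. -/
theorem eventually_sign_topCoeff_eq (o : OrientationForm n M) (c : M)
    {y : EuclideanSpace ℝ (Fin n)} (hy : y ∈ (chartAt (EuclideanSpace ℝ (Fin n)) c).target) :
    ∀ᶠ z in nhds y, Real.sign (topCoeff o.form c z) = Real.sign (topCoeff o.form c y) :=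
  eventually_sign_eq ((contDiffOn_topCoeff o.form c).continuousOn.continuousAt
    ((chartAt (EuclideanSpace ℝ (Fin n)) c).open_target.mem_nhds hy)) (topCoeff_ne_zero o c hy)

/-- A function on the chart at `c`, multiplied by the sign of the chart and extended by zero. -/
noncomputable def signExtend (o : OrientationForm n M) (c : M) {V : Type*} [AddCommGroup V]
    [Module ℝ V] (h : EuclideanSpace ℝ (Fin n) → V) : EuclideanSpace ℝ (Fin n) → V :=
  (chartAt (EuclideanSpace ℝ (Fin n)) c).target.indicator
    fun y => Real.sign (topCoeff o.form c y) • h y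

section SignExtend
variable (o : OrientationForm n M) (c : M) {V : Type*} [NormedAddCommGroup V] [NormedSpace ℝ V]
  {h : EuclideanSpace ℝ (Fin n) → V} {K : Set M}

theorem signExtend_eventuallyEq {y : EuclideanSpace ℝ (Fin n)}
    (hy : y ∈ (chartAt (EuclideanSpace ℝ (Fin n)) c).target) :
    signExtend o c h =ᶠ[nhds y] fun z => Real.sign (topCoeff o.form c y) • h z := by
  filter_upwards [eventually_sign_topCoeff_eq o c hy,
    (chartAt (EuclideanSpace ℝ (Fin n)) c).open_target.mem_nhds hy] with z hz hz'
  rw [signExtend, indicator_of_mem hz', hz]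

theorem signExtend_eq_zero_of_notMem_image
    (h0 : ∀ y ∈ (chartAt (EuclideanSpace ℝ (Fin n)) c).target,
      (chartAt (EuclideanSpace ℝ (Fin n)) c).symm y ∉ K → h y = 0)
    {y : EuclideanSpace ℝ (Fin n)} (hy : y ∉ chartAt (EuclideanSpace ℝ (Fin n)) c '' K) :
    signExtend o c h y = 0 := by
  by_cases hyt : y ∈ (chartAt (EuclideanSpace ℝ (Fin n)) c).target
  · rw [signExtend, indicator_of_mem hyt, h0 y hyt, smul_zero]
    exact fun hK => hy ⟨_, hK, (chartAt (EuclideanSpace ℝ (Fin n)) c).right_inv hyt⟩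
  · exact indicator_of_notMem hyt _

theorem isCompact_chart_image {K : Set M} [CompactSpace M] (hK : IsClosed K)
    (hKc : K ⊆ (chartAt (EuclideanSpace ℝ (Fin n)) c).source) :
    IsCompact (chartAt (EuclideanSpace ℝ (Fin n)) c '' K) :=
  hK.isCompact.image_of_continuousOn
    ((chartAt (EuclideanSpace ℝ (Fin n)) c).continuousOn.mono hKc)

theorem hasCompactSupport_signExtend [CompactSpace M] (hK : IsClosed K)
    (hKc : K ⊆ (chartAt (EuclideanSpace ℝ (Fin n)) c).source)
    (h0 : ∀ y ∈ (chartAt (EuclideanSpace ℝ (Fin n)) c).target,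
      (chartAt (EuclideanSpace ℝ (Fin n)) c).symm y ∉ K → h y = 0) :
    HasCompactSupport (signExtend o c h) :=
  HasCompactSupport.intro (isCompact_chart_image c hK hKc)
    fun _ hy => signExtend_eq_zero_of_notMem_image o c h0 hy

/-- Inside the chart target the sign is locally constant. A point outside the target also lies
outside the image of K, which is compact and hence closed, so the extension vanishes near that
point. -/
theorem contDiff_signExtend [CompactSpace M] (hK : IsClosed K)
    (hKc : K ⊆ (chartAt (EuclideanSpace ℝ (Fin n)) c).source)
    (h0 : ∀ y ∈ (chartAt (EuclideanSpace ℝ (Fin n)) c).target,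
      (chartAt (EuclideanSpace ℝ (Fin n)) c).symm y ∉ K → h y = 0)
    (hh : ContDiffOn ℝ ∞ h (chartAt (EuclideanSpace ℝ (Fin n)) c).target) :
    ContDiff ℝ ∞ (signExtend o c h) := by
  rw [contDiff_iff_contDiffAt]
  intro y
  by_cases hy : y ∈ (chartAt (EuclideanSpace ℝ (Fin n)) c).target
  · exact ((hh.contDiffAt ((chartAt (EuclideanSpace ℝ (Fin n)) c).open_target.mem_nhds
      hy)).const_smul _).congr_of_eventuallyEq (signExtend_eventuallyEq o c hy)
  · have hyK : y ∉ chartAt (EuclideanSpace ℝ (Fin n)) c '' K := by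
      rintro ⟨x, hx, rfl⟩
      exact hy ((chartAt (EuclideanSpace ℝ (Fin n)) c).map_source (hKc hx))
    refine (contDiffAt_const (c := (0 : V))).congr_of_eventuallyEq ?_
    filter_upwards [(isCompact_chart_image c hK hKc).isClosed.isOpen_compl.mem_nhds hyK] with z hz
    exact signExtend_eq_zero_of_notMem_image o c h0 hz

theorem integrableOn_sign_mul [CompactSpace M] {h : EuclideanSpace ℝ (Fin n) → ℝ}
    (hK : IsClosed K) (hKc : K ⊆ (chartAt (EuclideanSpace ℝ (Fin n)) c).source)
    (h0 : ∀ y ∈ (chartAt (EuclideanSpace ℝ (Fin n)) c).target,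
      (chartAt (EuclideanSpace ℝ (Fin n)) c).symm y ∉ K → h y = 0)
    (hh : ContDiffOn ℝ ∞ h (chartAt (EuclideanSpace ℝ (Fin n)) c).target) :
    MeasureTheory.IntegrableOn (fun y => Real.sign (topCoeff o.form c y) * h y)
      (chartAt (EuclideanSpace ℝ (Fin n)) c).target := by
  rw [← MeasureTheory.integrable_indicator_iff
    (chartAt (EuclideanSpace ℝ (Fin n)) c).open_target.measurableSet]
  exact (contDiff_signExtend o c hK hKc h0 hh).continuous.integrable_of_hasCompactSupport
    (hasCompactSupport_signExtend o c hK hKc h0)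

theorem setIntegral_sign_mul_eq (h : EuclideanSpace ℝ (Fin n) → ℝ) :
    ∫ y in (chartAt (EuclideanSpace ℝ (Fin n)) c).target,
      Real.sign (topCoeff o.form c y) * h y = ∫ y, signExtend o c h y :=
  (MeasureTheory.integral_indicator
    (chartAt (EuclideanSpace ℝ (Fin n)) c).open_target.measurableSet).symm

end SignExtend

theorem contDiffOn_comp_chart_symm {f : M → ℝ} (hf : ContMDiff (𝓡 n) 𝓘(ℝ, ℝ) ∞ f) (c : M) :
    ContDiffOn ℝ ∞ (fun y => f ((chartAt (EuclideanSpace ℝ (Fin n)) c).symm y))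
      (chartAt (EuclideanSpace ℝ (Fin n)) c).target :=
  contMDiffOn_iff_contDiffOn.1
    (hf.comp_contMDiffOn (contMDiffOn_chart_symm (I := 𝓡 n) (x := c)))

/-! ### Multiplication of forms by functions -/

/-- The product of a smooth function and a smooth form. -/
noncomputable def funSMul (f : M → ℝ) (hf : ContMDiff (𝓡 n) 𝓘(ℝ, ℝ) ∞ f) (η : DiffForm n M k) :
    DiffForm n M k :=
  ⟨fun x => f x • η.1 x, fun c => ((contDiffOn_comp_chart_symm hf c).smul (η.2 c)).congr
    fun _ _ => rfl⟩

theorem topCoeff_funSMul (f : M → ℝ) (hf : ContMDiff (𝓡 n) 𝓘(ℝ, ℝ) ∞ f) (η : DiffForm n M n)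
    (c : M) (y : EuclideanSpace ℝ (Fin n)) :
    topCoeff (funSMul f hf η) c y =
      f ((chartAt (EuclideanSpace ℝ (Fin n)) c).symm y) * topCoeff η c y := rfl

/-! ### Change of charts -/

theorem topCoeff_transition (η : DiffForm n M n) (c d : M)
    {z : EuclideanSpace ℝ (Fin n)} (hz : z ∈ (chartAt (EuclideanSpace ℝ (Fin n)) c).target)
    (hzd : (chartAt (EuclideanSpace ℝ (Fin n)) c).symm z ∈
      (chartAt (EuclideanSpace ℝ (Fin n)) d).source) :
    topCoeff η c z =
      (fderiv ℝ ((chartAt (EuclideanSpace ℝ (Fin n)) d) ∘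
          (chartAt (EuclideanSpace ℝ (Fin n)) c).symm) z).det *
        topCoeff η d ((chartAt (EuclideanSpace ℝ (Fin n)) d)
          ((chartAt (EuclideanSpace ℝ (Fin n)) c).symm z)) := by
  rw [topCoeff, localRep_transition η.1 c d hz hzd]
  exact ContinuousAlternatingMap.map_comp_eq_det_mul _ _

theorem Real.sign_mul_eq (a b : ℝ) : Real.sign (a * b) = Real.sign a * Real.sign b := by
  rcases lt_trichotomy a 0 with ha | rfl | ha <;> rcases lt_trichotomy b 0 with hb | rfl | hb <;>
    simp [*, Real.sign_of_neg, Real.sign_of_pos, mul_pos_of_neg_of_neg, mul_neg_of_neg_of_pos,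
      mul_neg_of_pos_of_neg]

theorem Real.sign_mul_self_eq_abs (a : ℝ) : Real.sign a * a = |a| := by
  rcases lt_trichotomy a 0 with ha | rfl | ha <;>
    simp [*, Real.sign_of_neg, Real.sign_of_pos, abs_of_neg, abs_of_pos]

/-- The integrals of a top-degree form over the intersection of two charts, computed in either
chart, agree. -/
theorem setIntegral_change_chart (o : OrientationForm n M) (η : DiffForm n M n) (f : M → ℝ)
    (c d : M) :
    ∫ y in (chartAt (EuclideanSpace ℝ (Fin n)) d).target ∩
        (chartAt (EuclideanSpace ℝ (Fin n)) d).symm ⁻¹'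
          (chartAt (EuclideanSpace ℝ (Fin n)) c).source,
      Real.sign (topCoeff o.form d y) *
        (f ((chartAt (EuclideanSpace ℝ (Fin n)) d).symm y) * topCoeff η d y) =
    ∫ y in (chartAt (EuclideanSpace ℝ (Fin n)) c).target ∩
        (chartAt (EuclideanSpace ℝ (Fin n)) c).symm ⁻¹'
          (chartAt (EuclideanSpace ℝ (Fin n)) d).source,
      Real.sign (topCoeff o.form c y) *
        (f ((chartAt (EuclideanSpace ℝ (Fin n)) c).symm y) * topCoeff η c y) := by
  set e := chartAt (EuclideanSpace ℝ (Fin n)) c with he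
  set e' := chartAt (EuclideanSpace ℝ (Fin n)) d with he'
  have himg : (e' ∘ e.symm) '' (e.target ∩ e.symm ⁻¹' e'.source) =
      e'.target ∩ e'.symm ⁻¹' e.source := by
    ext y
    constructor
    · rintro ⟨z, ⟨hz, hz'⟩, rfl⟩
      refine ⟨e'.map_source hz', ?_⟩
      simpa [e'.left_inv hz'] using e.map_target hz
    · rintro ⟨hy, hy'⟩
      refine ⟨e (e'.symm y), ⟨e.map_source hy', ?_⟩, ?_⟩
      · simpa [e.left_inv hy'] using e'.map_target hy
      · simp [e.left_inv hy', e'.right_inv hy]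
  have hopen : IsOpen (e.target ∩ e.symm ⁻¹' e'.source) :=
    e.isOpen_inter_preimage_symm e'.open_source
  have hderiv : ∀ z ∈ e.target ∩ e.symm ⁻¹' e'.source,
      HasFDerivWithinAt (e' ∘ e.symm) (fderiv ℝ (e' ∘ e.symm) z)
        (e.target ∩ e.symm ⁻¹' e'.source) z := fun z hz =>
    ((contDiffAt_transition c d hz.1 hz.2).differentiableAt
      (by simp)).hasFDerivAt.hasFDerivWithinAt
  have hinj : InjOn (e' ∘ e.symm) (e.target ∩ e.symm ⁻¹' e'.source) := fun y hy z hz h =>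
    e.symm.injOn hy.1 hz.1 (e'.injOn hy.2 hz.2 h)
  rw [← himg, MeasureTheory.integral_image_eq_integral_abs_det_fderiv_smul _ hopen.measurableSet
    hderiv hinj]
  refine MeasureTheory.setIntegral_congr_fun hopen.measurableSet fun z hz => ?_
  simp only [Function.comp_apply, smul_eq_mul]
  -- Both coefficients scale by the same Jacobian determinant J. The orientation contributes sign J
  -- and the form contributes J, and sign J · J = |J| is the factor in the change of variables
  -- formula; the charts need not be compatibly oriented.
  rw [topCoeff_transition o.form c d hz.1 hz.2, topCoeff_transition η c d hz.1 hz.2,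
    Real.sign_mul_eq, ← Real.sign_mul_self_eq_abs, ← he, ← he', e'.left_inv hz.2]
  simp only [Function.comp_def]
  ring

end ChartIntegrals

/-! ### Linearity of the integral and its computation in a single chart -/

section Integral
variable {n : ℕ} {M : Type*} [TopologicalSpace M] [ChartedSpace (EuclideanSpace ℝ (Fin n)) M]
  [IsManifold (𝓡 n) ∞ M] [T2Space M] [CompactSpace M]

theorem chartPartition_isSubordinate : (chartPartition n M).IsSubordinate
    fun x => (chartAt (EuclideanSpace ℝ (Fin n)) x).source :=
  (SmoothPartitionOfUnity.exists_isSubordinate_chartAt_source (𝓡 n) M).choose_spec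

variable (n M) in
theorem finite_chartPartition_support :
    {c : M | (Function.support (chartPartition n M c)).Nonempty}.Finite :=
  (chartPartition n M).locallyFinite.finite_nonempty_of_compact

variable (n M) in
/-- The finitely many indices of the nonzero functions of the partition of unity. -/
noncomputable def chartIndices : Finset M := (finite_chartPartition_support n M).toFinset

theorem chartPartition_eq_zero {c : M} (hc : c ∉ chartIndices n M) (x : M) :
    chartPartition n M c x = 0 := by
  by_contra h
  exact hc ((finite_chartPartition_support n M).mem_toFinset.2 ⟨x, h⟩)

theorem sum_chartPartition (x : M) : ∑ c ∈ chartIndices n M, chartPartition n M c x = 1 := by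
  rw [← (chartPartition n M).sum_eq_one (mem_univ x)]
  refine (finsum_eq_sum_of_support_subset _ fun c hc => ?_).symm
  by_contra h
  exact hc (chartPartition_eq_zero h x)

theorem integral_eq_sum (o : OrientationForm n M) (η : DiffForm n M n) :
    integral o η = ∑ c ∈ chartIndices n M,
      ∫ y in (chartAt (EuclideanSpace ℝ (Fin n)) c).target,
        Real.sign (topCoeff o.form c y) *
          (chartPartition n M c ((chartAt (EuclideanSpace ℝ (Fin n)) c).symm y) *
            topCoeff η c y) := by
  refine finsum_eq_sum_of_support_subset _ fun c hc => ?_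
  by_contra h
  refine hc ?_
  simp [chartPartition_eq_zero (Finset.mem_coe.not.1 h)]

theorem integrableOn_chartPartition_mul (o : OrientationForm n M) (η : DiffForm n M n) (c : M) :
    MeasureTheory.IntegrableOn (fun y => Real.sign (topCoeff o.form c y) *
          (chartPartition n M c ((chartAt (EuclideanSpace ℝ (Fin n)) c).symm y) *
            topCoeff η c y)) (chartAt (EuclideanSpace ℝ (Fin n)) c).target :=
  integrableOn_sign_mul o c (isClosed_tsupport (chartPartition n M c))
    (chartPartition_isSubordinate c)
    (fun y _ h => by rw [image_eq_zero_of_notMem_tsupport h, zero_mul])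
    ((contDiffOn_comp_chart_symm (chartPartition n M c).contMDiff c).mul (contDiffOn_topCoeff η c))

theorem integral_add (o : OrientationForm n M) (η ζ : DiffForm n M n) :
    integral o (η + ζ) = integral o η + integral o ζ := by
  simp only [integral_eq_sum, ← Finset.sum_add_distrib]
  refine Finset.sum_congr rfl fun c _ => ?_
  rw [← MeasureTheory.integral_add (integrableOn_chartPartition_mul o η c)
    (integrableOn_chartPartition_mul o ζ c)]
  simp only [topCoeff_add, mul_add]

theorem integral_smul (o : OrientationForm n M) (r : ℝ) (η : DiffForm n M n) :
    integral o (r • η) = r * integral o η := by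
  simp only [integral_eq_sum, Finset.mul_sum]
  refine Finset.sum_congr rfl fun c _ => ?_
  rw [← MeasureTheory.integral_const_mul]
  simp only [topCoeff_smul, mul_left_comm r]

/-- The integral as a linear functional on top-degree forms. -/
noncomputable def integralₗ (o : OrientationForm n M) : DiffForm n M n →ₗ[ℝ] ℝ where
  toFun := integral o
  map_add' := integral_add o
  map_smul' := integral_smul o

/-- The integral of a form supported in the domain of one chart can be computed in that chart. -/
theorem integral_eq_setIntegral (o : OrientationForm n M) (η : DiffForm n M n) (c : M) {K : Set M}
    (hK : IsClosed K) (hKc : K ⊆ (chartAt (EuclideanSpace ℝ (Fin n)) c).source)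
    (h0 : ∀ x ∉ K, η.1 x = 0) :
    integral o η = ∫ y in (chartAt (EuclideanSpace ℝ (Fin n)) c).target,
      Real.sign (topCoeff o.form c y) * topCoeff η c y := by
  -- Each piece of the partition moves from its own chart d to the chart c. Both integrals reduce to
  -- the overlap: off it, the partition function of d vanishes in the chart c, and η vanishes in the
  -- chart d.
  have hpart : ∀ d, ∫ y in (chartAt (EuclideanSpace ℝ (Fin n)) d).target,
        Real.sign (topCoeff o.form d y) *
          (chartPartition n M d ((chartAt (EuclideanSpace ℝ (Fin n)) d).symm y) *
            topCoeff η d y) =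
      ∫ y in (chartAt (EuclideanSpace ℝ (Fin n)) c).target,
        Real.sign (topCoeff o.form c y) *
          (chartPartition n M d ((chartAt (EuclideanSpace ℝ (Fin n)) c).symm y) *
            topCoeff η c y) := by
    intro d
    have h1 := setIntegral_change_chart o η (chartPartition n M d) c d
    rw [MeasureTheory.setIntegral_eq_of_subset_of_forall_sdiff_eq_zero
      (chartAt (EuclideanSpace ℝ (Fin n)) d).open_target.measurableSet
      (s := (chartAt (EuclideanSpace ℝ (Fin n)) d).target ∩
        (chartAt (EuclideanSpace ℝ (Fin n)) d).symm ⁻¹'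
          (chartAt (EuclideanSpace ℝ (Fin n)) c).source) inter_subset_left, h1,
      MeasureTheory.setIntegral_eq_of_subset_of_forall_sdiff_eq_zero
      (chartAt (EuclideanSpace ℝ (Fin n)) c).open_target.measurableSet
      (s := (chartAt (EuclideanSpace ℝ (Fin n)) c).target ∩
        (chartAt (EuclideanSpace ℝ (Fin n)) c).symm ⁻¹'
          (chartAt (EuclideanSpace ℝ (Fin n)) d).source) inter_subset_left]
    · rintro y ⟨hy, hy'⟩
      rw [image_eq_zero_of_notMem_tsupport
        fun h => hy' ⟨hy, chartPartition_isSubordinate d h⟩, zero_mul, mul_zero]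
    · rintro y ⟨hy, hy'⟩
      rw [topCoeff_eq_zero d (h0 _ fun h => hy' ⟨hy, hKc h⟩), mul_zero, mul_zero]
  rw [integral_eq_sum, Finset.sum_congr rfl fun d _ => hpart d, ← MeasureTheory.integral_finsetSum]
  · refine MeasureTheory.integral_congr_ae (Filter.Eventually.of_forall fun y => ?_)
    simp only [← Finset.mul_sum, ← Finset.sum_mul, sum_chartPartition, one_mul]
  · intro d _
    exact integrableOn_sign_mul o c hK hKc
      (fun y _ h => by rw [topCoeff_eq_zero c (h0 _ h), mul_zero])
      ((contDiffOn_comp_chart_symm (chartPartition n M d).contMDiff c).mul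
        (contDiffOn_topCoeff η c))

end Integral

/-! ### Stokes' theorem -/

theorem extDeriv_const_zero {E : Type*} [NormedAddCommGroup E] [NormedSpace ℝ E] {k : ℕ} (x : E) :
    extDeriv (fun _ : E => (0 : E [⋀^Fin k]→L[ℝ] ℝ)) x = 0 := by
  ext v
  rw [extDeriv_apply (differentiableAt_const _)]
  simp

theorem integrable_fderiv_apply {E : Type*} [NormedAddCommGroup E] [NormedSpace ℝ E]
    [MeasurableSpace E] [BorelSpace E] (μ : MeasureTheory.Measure E)
    [MeasureTheory.IsFiniteMeasureOnCompacts μ] {f : E → ℝ} (hf : ContDiff ℝ 1 f)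
    (hc : HasCompactSupport f) (v : E) :
    MeasureTheory.Integrable (fun x => fderiv ℝ f x v) μ :=
  ((hf.continuous_fderiv (by simp)).clm_apply continuous_const).integrable_of_hasCompactSupport
      (hc.fderiv_apply (𝕜 := ℝ) v)

/-- Integration by parts against the constant function 1. -/
theorem integral_fderiv_apply_eq_zero {E : Type*} [NormedAddCommGroup E] [NormedSpace ℝ E]
    [FiniteDimensional ℝ E] [MeasurableSpace E] [BorelSpace E] (μ : MeasureTheory.Measure E)
    [μ.IsAddHaarMeasure] {f : E → ℝ} (hf : ContDiff ℝ 1 f) (hc : HasCompactSupport f) (v : E) :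
    ∫ x, fderiv ℝ f x v ∂μ = 0 := by
  have h := integral_mul_fderiv_eq_neg_fderiv_mul_of_integrable (μ := μ) (f := fun _ : E => (1 : ℝ))
    (g := f) (v := v) (by simp) ?_ ?_ (by fun_prop)
    (fun x _ => (hf.differentiable (by simp)).differentiableAt)
  · simpa using h
  · simpa only [one_mul] using integrable_fderiv_apply μ hf hc v
  · simpa using hf.continuous.integrable_of_hasCompactSupport hc

/-- On constant vectors dα is an alternating sum of directional derivatives of compactly supported
coefficients, each of which integrates to zero. -/
theorem integral_extDeriv_apply_eq_zero {E : Type*} [NormedAddCommGroup E] [NormedSpace ℝ E]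
    [FiniteDimensional ℝ E] [MeasurableSpace E] [BorelSpace E] (μ : MeasureTheory.Measure E)
    [μ.IsAddHaarMeasure] {m : ℕ} {α : E → E [⋀^Fin m]→L[ℝ] ℝ} (hα : ContDiff ℝ 1 α)
    (hc : HasCompactSupport α) (v : Fin (m + 1) → E) :
    ∫ x, extDeriv α x v ∂μ = 0 := by
  have hcoeff : ∀ i : Fin (m + 1), ContDiff ℝ 1 fun x => α x (i.removeNth v) := fun i =>
    (ContinuousAlternatingMap.apply ℝ E ℝ (i.removeNth v)).contDiff.comp hα
  have hsupp : ∀ i : Fin (m + 1), HasCompactSupport fun x => α x (i.removeNth v) := fun i =>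
    hc.comp_left (g := fun β : E [⋀^Fin m]→L[ℝ] ℝ => β (i.removeNth v)) rfl
  simp_rw [fun x => extDeriv_apply ((hα.differentiable (by simp)) x) v]
  refine (MeasureTheory.integral_finsetSum _ fun i _ =>
    (integrable_fderiv_apply μ (hcoeff i) (hsupp i) (v i)).smul ((-1 : ℤ) ^ (i : ℕ))).trans ?_
  refine Finset.sum_eq_zero fun i _ => ?_
  have h := integral_fderiv_apply_eq_zero μ (hcoeff i) (hsupp i) (v i)
  rcases neg_one_pow_eq_or ℤ (i : ℕ) with h1 | h1 <;> rw [h1] <;>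
    simp [MeasureTheory.integral_neg, h]

section Stokes
variable {m : ℕ} {M : Type*} [TopologicalSpace M]
  [ChartedSpace (EuclideanSpace ℝ (Fin (m + 1))) M]
  [IsManifold (𝓡 (m + 1)) ∞ M] [T2Space M] [CompactSpace M]

theorem dForm_apply_eq_zero {n k : ℕ} {M : Type*} [TopologicalSpace M]
    [ChartedSpace (EuclideanSpace ℝ (Fin n)) M] [IsManifold (𝓡 n) ∞ M] {η : DiffForm n M k}
    {K : Set M} (hK : IsClosed K) (h0 : ∀ x ∉ K, η.1 x = 0) {x : M} (hx : x ∉ K) :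
    (dForm n M k η).1 x = 0 := by
  have hev : localRep η.1 x =ᶠ[nhds (chartAt (EuclideanSpace ℝ (Fin n)) x x)] fun _ => 0 := by
    have h1 := (chartAt (EuclideanSpace ℝ (Fin n)) x).isOpen_inter_preimage_symm hK.isOpen_compl
    filter_upwards [h1.mem_nhds ⟨mem_chart_target _ x, by simpa using hx⟩] with y hy
    exact localRep_eq_zero x (h0 _ hy.2)
  change (extDeriv (localRep η.1 x) (chartAt (EuclideanSpace ℝ (Fin n)) x x)).compContinuousLinearMap
    (chartDeriv x) = 0
  rw [hev.extDeriv_eq, extDeriv_const_zero]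
  rfl

/-- The local expression of η, multiplied by the sign of the chart and extended by zero, is a smooth
compactly supported form on all of ℝⁿ, so the Euclidean case applies to it. -/
theorem integral_dForm_eq_zero_of_support (o : OrientationForm (m + 1) M)
    (η : DiffForm (m + 1) M m) (c : M) {K : Set M} (hK : IsClosed K)
    (hKc : K ⊆ (chartAt (EuclideanSpace ℝ (Fin (m + 1))) c).source)
    (h0 : ∀ x ∉ K, η.1 x = 0) : integral o (dForm (m + 1) M m η) = 0 := by
  rw [integral_eq_setIntegral o _ c hK hKc fun x hx => dForm_apply_eq_zero hK h0 hx]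
  have h0' : ∀ y ∈ (chartAt (EuclideanSpace ℝ (Fin (m + 1))) c).target,
      (chartAt (EuclideanSpace ℝ (Fin (m + 1))) c).symm y ∉ K → localRep η.1 c y = 0 :=
    fun y _ hy => localRep_eq_zero c (h0 _ hy)
  have hsm := contDiff_signExtend o c hK hKc h0' (η.2 c)
  refine Eq.trans ?_ ((MeasureTheory.setIntegral_eq_integral_of_forall_compl_eq_zero
    (s := (chartAt (EuclideanSpace ℝ (Fin (m + 1))) c).target) ?_).trans
    (integral_extDeriv_apply_eq_zero MeasureTheory.volume (hsm.of_le (by simp))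
    (hasCompactSupport_signExtend o c hK hKc h0') (EuclideanSpace.basisFun (Fin (m + 1)) ℝ)))
  · refine MeasureTheory.setIntegral_congr_fun
      (chartAt (EuclideanSpace ℝ (Fin (m + 1))) c).open_target.measurableSet fun y hy => ?_
    -- Near y the sign is a constant, so it commutes with the exterior derivative.
    have h1 := (signExtend_eventuallyEq o c (h := localRep η.1 c) hy).extDeriv_eq
    have h2 := extDeriv_smul (Real.sign (topCoeff o.form c y)) (localRep η.1 c) (x := y)
    have h3 : topCoeff (dForm (m + 1) M m η) c y =
        extDeriv (localRep η.1 c) y (EuclideanSpace.basisFun (Fin (m + 1)) ℝ) :=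
      DFunLike.congr_fun (localRep_rawExtDeriv η.2 c hy) _
    rw [h1, h3]
    exact (DFunLike.congr_fun h2 _).symm
  · intro y hy
    have hyK : y ∉ chartAt (EuclideanSpace ℝ (Fin (m + 1))) c '' K := by
      rintro ⟨x, hx, rfl⟩
      exact hy ((chartAt (EuclideanSpace ℝ (Fin (m + 1))) c).map_source (hKc hx))
    have hev : signExtend o c (localRep η.1 c) =ᶠ[nhds y] fun _ => 0 := by
      filter_upwards [(isCompact_chart_image c hK hKc).isClosed.isOpen_compl.mem_nhds hyK] with z hz
      exact signExtend_eq_zero_of_notMem_image o c h0' hz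
    rw [hev.extDeriv_eq, extDeriv_const_zero]
    rfl

/-- Stokes' theorem on a closed oriented manifold. -/
theorem integral_dForm (o : OrientationForm (m + 1) M) (η : DiffForm (m + 1) M m) :
    integral o (dForm (m + 1) M m η) = 0 := by
  -- The primitive η is cut up rather than dη, so each summand stays exact and no derivative of the
  -- partition functions appears.
  have hη : η = ∑ c ∈ chartIndices (m + 1) M,
      funSMul (chartPartition (m + 1) M c) (chartPartition (m + 1) M c).contMDiff η := by
    refine DiffForm.ext_apply fun x => ?_
    have h1 : (∑ c ∈ chartIndices (m + 1) M, funSMul (chartPartition (m + 1) M c)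
        (chartPartition (m + 1) M c).contMDiff η).1 x =
        ∑ c ∈ chartIndices (m + 1) M, chartPartition (m + 1) M c x • η.1 x :=
      map_sum (({ toFun := fun ζ => ζ.1 x, map_zero' := rfl, map_add' := fun _ _ => rfl } :
        DiffForm (m + 1) M m →+ _)) _ _
    rw [h1, ← Finset.sum_smul, sum_chartPartition, one_smul]
  change integralₗ o _ = 0
  rw [hη, map_sum, map_sum]
  refine Finset.sum_eq_zero fun c _ => ?_
  refine integral_dForm_eq_zero_of_support o _ c (isClosed_tsupport (chartPartition (m + 1) M c))
    (chartPartition_isSubordinate c) fun x hx => ?_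
  change chartPartition (m + 1) M c x • η.1 x = 0
  rw [image_eq_zero_of_notMem_tsupport hx, zero_smul]

end Stokes

/-! ### Explicit wedge products in degrees two and three -/

section Wedge
variable {E : Type*} [AddCommGroup E] [Module ℝ E] [TopologicalSpace E]

theorem sum_perm_fin_three {R : Type*} [AddCommMonoid R] (f : Equiv.Perm (Fin 3) → R) :
    ∑ σ, f σ = f 1 + f (Equiv.swap 0 1) + f (Equiv.swap 0 2) + f (Equiv.swap 1 2) +
      f (Equiv.swap 0 1 * Equiv.swap 1 2) + f (Equiv.swap 1 2 * Equiv.swap 0 1) := by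
  have : (Finset.univ : Finset (Equiv.Perm (Fin 3))) = {1, Equiv.swap 0 1, Equiv.swap 0 2,
      Equiv.swap 1 2, Equiv.swap 0 1 * Equiv.swap 1 2, Equiv.swap 1 2 * Equiv.swap 0 1} := by
    decide
  rw [this, Finset.sum_insert (by decide), Finset.sum_insert (by decide),
    Finset.sum_insert (by decide), Finset.sum_insert (by decide), Finset.sum_insert (by decide),
    Finset.sum_singleton]
  simp only [add_assoc]

theorem ContinuousAlternatingMap.map_swap_two (α : E [⋀^Fin 2]→L[ℝ] ℝ) (a b : E) :
    α ![a, b] = -α ![b, a] := by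
  refine Eq.trans ?_ (α.map_swap ![b, a] (i := 0) (j := 1) (by decide))
  exact congrArg α (by funext i; fin_cases i <;> rfl)

theorem altWedge_one_one_apply (α β : E [⋀^Fin 1]→L[ℝ] ℝ) (v : Fin 2 → E) :
    altWedge α β v = α (fun _ => v 0) * β (fun _ => v 1) - α (fun _ => v 1) * β (fun _ => v 0) := by
  have hu : (Finset.univ : Finset (Equiv.Perm (Fin 2))) = {1, Equiv.swap 0 1} := by decide
  have h0 : ∀ σ : Equiv.Perm (Fin 2),
      (fun i : Fin 1 => v (σ (Fin.castAdd 1 i))) = fun _ => v (σ 0) := fun σ => by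
    funext i; fin_cases i; rfl
  have h1 : ∀ σ : Equiv.Perm (Fin 2),
      (fun i : Fin 1 => v (σ (Fin.natAdd 1 i))) = fun _ => v (σ 1) := fun σ => by
    funext i; fin_cases i; rfl
  refine (altWedge_apply α β v).trans ?_
  -- The index type `Fin (1 + 1)` is `Fin 2` only by unfolding. For the same reason later equations
  -- between degrees such as 1 + 2 and 3 are glued with `trans` and `congrArg`.
  change _ * ∑ σ : Equiv.Perm (Fin 2), _ = _
  rw [hu, Finset.sum_insert (by decide), Finset.sum_singleton]
  simp only [h0, h1]
  simp [sub_eq_add_neg]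

/-- The six permutations pair off by a swap of the two arguments of α; the factor 1/(2! 1!) cancels
this doubling. -/
theorem altWedge_two_one_apply (α : E [⋀^Fin 2]→L[ℝ] ℝ) (β : E [⋀^Fin 1]→L[ℝ] ℝ)
    (v : Fin 3 → E) :
    altWedge α β v = α ![v 0, v 1] * β (fun _ => v 2) - α ![v 0, v 2] * β (fun _ => v 1) +
      α ![v 1, v 2] * β (fun _ => v 0) := by
  have h0 : ∀ σ : Equiv.Perm (Fin 3),
      (fun i : Fin 2 => v (σ (Fin.castAdd 1 i))) = ![v (σ 0), v (σ 1)] := fun σ => by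
    funext i; fin_cases i <;> rfl
  have h1 : ∀ σ : Equiv.Perm (Fin 3),
      (fun i : Fin 1 => v (σ (Fin.natAdd 2 i))) = fun _ => v (σ 2) := fun σ => by
    funext i; fin_cases i; rfl
  refine (altWedge_apply α β v).trans ?_
  change _ * ∑ σ : Equiv.Perm (Fin 3), _ = _
  rw [sum_perm_fin_three]
  simp only [h0, h1]
  simp [Equiv.swap_apply_def]
  rw [α.map_swap_two (v 1) (v 0), α.map_swap_two (v 2) (v 1), α.map_swap_two (v 2) (v 0)]
  ring

theorem altWedge_one_two_apply (α : E [⋀^Fin 1]→L[ℝ] ℝ) (β : E [⋀^Fin 2]→L[ℝ] ℝ)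
    (v : Fin 3 → E) :
    altWedge α β v = α (fun _ => v 0) * β ![v 1, v 2] - α (fun _ => v 1) * β ![v 0, v 2] +
      α (fun _ => v 2) * β ![v 0, v 1] := by
  have h0 : ∀ σ : Equiv.Perm (Fin 3),
      (fun i : Fin 1 => v (σ (Fin.castAdd 2 i))) = fun _ => v (σ 0) := fun σ => by
    funext i; fin_cases i; rfl
  have h1 : ∀ σ : Equiv.Perm (Fin 3),
      (fun i : Fin 2 => v (σ (Fin.natAdd 1 i))) = ![v (σ 1), v (σ 2)] := fun σ => by
    funext i; fin_cases i <;> rfl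
  refine (altWedge_apply α β v).trans ?_
  change _ * ∑ σ : Equiv.Perm (Fin 3), _ = _
  rw [sum_perm_fin_three]
  simp only [h0, h1]
  simp [Equiv.swap_apply_def]
  rw [β.map_swap_two (v 1) (v 0), β.map_swap_two (v 2) (v 1), β.map_swap_two (v 2) (v 0)]
  ring

theorem altWedge_comm_one_one (α β : E [⋀^Fin 1]→L[ℝ] ℝ) :
    altWedge α β = -altWedge β α := by
  ext v
  refine (altWedge_one_one_apply α β v).trans ?_
  refine Eq.trans ?_ (congrArg Neg.neg (altWedge_one_one_apply β α v)).symm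
  ring

theorem altWedge_comm_two_one (α : E [⋀^Fin 2]→L[ℝ] ℝ) (β : E [⋀^Fin 1]→L[ℝ] ℝ) :
    (altWedge α β : E [⋀^Fin 3]→L[ℝ] ℝ) = altWedge β α := by
  ext v
  refine (altWedge_two_one_apply α β v).trans ?_
  refine Eq.trans ?_ (altWedge_one_two_apply β α v).symm
  ring

/-- Both triple products are 3 × 3 determinants, with two rows interchanged. Expanding them avoids
any appeal to associativity of the wedge. -/
theorem altWedge_altWedge_comm (α β γ : E [⋀^Fin 1]→L[ℝ] ℝ) :
    (altWedge (altWedge α β : E [⋀^Fin 2]→L[ℝ] ℝ) γ : E [⋀^Fin 3]→L[ℝ] ℝ) =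
      -altWedge (altWedge α γ : E [⋀^Fin 2]→L[ℝ] ℝ) β := by
  ext v
  refine (altWedge_two_one_apply _ γ v).trans ?_
  refine Eq.trans ?_ (congrArg Neg.neg (altWedge_two_one_apply _ β v)).symm
  have h := fun (α β : E [⋀^Fin 1]→L[ℝ] ℝ) (u w : E) => altWedge_one_one_apply α β ![u, w]
  simp only [Matrix.cons_val_zero, Matrix.cons_val_one] at h
  simp only [h]
  ring

end Wedge

/-! ### The exterior derivative in low degree and the Leibniz rule -/

theorem extDeriv_one_apply {E : Type*} [NormedAddCommGroup E] [NormedSpace ℝ E]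
    (α : E → E [⋀^Fin 1]→L[ℝ] ℝ) (x : E) (v : Fin 2 → E) :
    extDeriv α x v = fderiv ℝ α x (v 0) (fun _ => v 1) - fderiv ℝ α x (v 1) (fun _ => v 0) := by
  have h0 : Fin.removeNth 0 v = fun _ => v 1 := by funext i; fin_cases i; rfl
  have h1 : Fin.removeNth 1 v = fun _ => v 0 := by funext i; fin_cases i; rfl
  refine (ContinuousAlternatingMap.alternatizeUncurryFin_apply _ _).trans ?_
  simp [Fin.sum_univ_two, h0, h1, sub_eq_add_neg]

theorem extDeriv_two_apply {E : Type*} [NormedAddCommGroup E] [NormedSpace ℝ E]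
    (α : E → E [⋀^Fin 2]→L[ℝ] ℝ) (x : E) (v : Fin 3 → E) :
    extDeriv α x v = fderiv ℝ α x (v 0) ![v 1, v 2] - fderiv ℝ α x (v 1) ![v 0, v 2] +
      fderiv ℝ α x (v 2) ![v 0, v 1] := by
  have h0 : Fin.removeNth 0 v = ![v 1, v 2] := by funext i; fin_cases i <;> rfl
  have h1 : Fin.removeNth 1 v = ![v 0, v 2] := by funext i; fin_cases i <;> rfl
  have h2 : Fin.removeNth 2 v = ![v 0, v 1] := by funext i; fin_cases i <;> rfl
  refine (ContinuousAlternatingMap.alternatizeUncurryFin_apply _ _).trans ?_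
  simp [Fin.sum_univ_three, h0, h1, h2, sub_eq_add_neg]

theorem extDeriv_altWedge_one_one {E : Type*} [NormedAddCommGroup E] [NormedSpace ℝ E]
    [FiniteDimensional ℝ E] {α β : E → E [⋀^Fin 1]→L[ℝ] ℝ} {x : E}
    (hα : DifferentiableAt ℝ α x) (hβ : DifferentiableAt ℝ β x) :
    (extDeriv (fun y => (altWedge (α y) (β y) : E [⋀^Fin 2]→L[ℝ] ℝ)) x :
      E [⋀^Fin 3]→L[ℝ] ℝ) =
      altWedge (extDeriv α x) (β x) - altWedge (α x) (extDeriv β x) := by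
  have := finiteDimensional_alt E 1
  -- Finite dimension makes the algebraic wedge continuous, so the product rule for bilinear maps
  -- applies; the rest is antisymmetrization of its two terms.
  let W : (E [⋀^Fin 1]→L[ℝ] ℝ) →L[ℝ] (E [⋀^Fin 1]→L[ℝ] ℝ) →L[ℝ] (E [⋀^Fin 2]→L[ℝ] ℝ) :=
    (altWedgeₗ E 1 1).toContinuousBilinearMap
  have hW : HasFDerivAt (fun y => (altWedge (α y) (β y) : E [⋀^Fin 2]→L[ℝ] ℝ)) _ x :=
    W.hasFDerivAt_of_bilinear hα.hasFDerivAt hβ.hasFDerivAt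
  have hd : ∀ u : E, fderiv ℝ (fun y => (altWedge (α y) (β y) : E [⋀^Fin 2]→L[ℝ] ℝ)) x u =
      altWedge (α x) (fderiv ℝ β x u) + altWedge (fderiv ℝ α x u) (β x) := fun u => by
    rw [hW.fderiv]
    rfl
  ext v
  rw [extDeriv_two_apply]
  refine Eq.trans ?_ (congrArg₂ (· - ·) (altWedge_two_one_apply (extDeriv α x) (β x) v)
    (altWedge_one_two_apply (α x) (extDeriv β x) v)).symm
  have h := fun (α β : E [⋀^Fin 1]→L[ℝ] ℝ) (u w : E) => altWedge_one_one_apply α β ![u, w]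
  have hα' := fun u w : E => extDeriv_one_apply α x ![u, w]
  have hβ' := fun u w : E => extDeriv_one_apply β x ![u, w]
  simp only [Matrix.cons_val_zero, Matrix.cons_val_one] at h hα' hβ'
  simp only [hd, ContinuousAlternatingMap.add_apply, h, hα', hβ']
  ring

section FormAlgebra
variable {n : ℕ} {M : Type*} [TopologicalSpace M] [ChartedSpace (EuclideanSpace ℝ (Fin n)) M]
  [IsManifold (𝓡 n) ∞ M]

theorem wedge_comm_one_one (a b : DiffForm n M 1) :
    (wedge n M 1 1 a b : DiffForm n M 2) = -wedge n M 1 1 b a :=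
  DiffForm.ext_apply fun x => altWedge_comm_one_one (a.1 x) (b.1 x)

theorem wedge_comm_two_one (a : DiffForm n M 2) (b : DiffForm n M 1) :
    (wedge n M 2 1 a b : DiffForm n M 3) = wedge n M 1 2 b a :=
  DiffForm.ext_apply fun x => altWedge_comm_two_one (a.1 x) (b.1 x)

theorem wedge_wedge_comm (a b c : DiffForm n M 1) :
    (wedge n M 2 1 (wedge n M 1 1 a b) c : DiffForm n M 3) =
      -wedge n M 2 1 (wedge n M 1 1 a c) b :=
  DiffForm.ext_apply fun x => altWedge_altWedge_comm (a.1 x) (b.1 x) (c.1 x)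

/-- The graded Leibniz rule for one-forms. -/
theorem dForm_wedge (a b : DiffForm n M 1) :
    (dForm n M 2 (wedge n M 1 1 a b) : DiffForm n M 3) =
      wedge n M 2 1 (dForm n M 1 a) b - wedge n M 1 2 a (dForm n M 1 b) := by
  refine DiffForm.ext_apply fun x => ?_
  set y := chartAt (EuclideanSpace ℝ (Fin n)) x x with hy
  have hrep : localRep (wedge n M 1 1 a b).1 x = fun z =>
      (altWedge (localRep a.1 x z) (localRep b.1 x z) :
        EuclideanSpace ℝ (Fin n) [⋀^Fin 2]→L[ℝ] ℝ) :=
    funext fun z => altWedge_comp _ _ _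
  have h1 := extDeriv_altWedge_one_one (differentiableAt_localRep a x)
    (differentiableAt_localRep b x)
  rw [← hrep] at h1
  -- Pulling the local expression back by the derivative of the chart recovers the form at x. This
  -- turns the Euclidean Leibniz rule into one on M.
  have hD : ∀ e : DiffForm n M 1,
      (localRep e.1 x y).compContinuousLinearMap (chartDeriv x) = e.1 x := fun e => by
    ext v
    exact localRep_comp_mfderiv e.1 x (mem_chart_source _ x) v
  refine (congrArg (fun α => ContinuousAlternatingMap.compContinuousLinearMap α (chartDeriv x))
    h1).trans ?_
  have h2 := altWedge_comp (extDeriv (localRep a.1 x) y) (localRep b.1 x y) (chartDeriv x)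
  have h3 := altWedge_comp (localRep a.1 x y) (extDeriv (localRep b.1 x) y) (chartDeriv x)
  rw [hD] at h2 h3
  exact congrArg₂ (· - ·) h2 h3

end FormAlgebra

/-! ### Symmetry of the quadratic and cubic terms, and the first variation -/

section Pairing
variable {M : Type*} [TopologicalSpace M] [ChartedSpace (EuclideanSpace ℝ (Fin 3)) M]
  [IsManifold (𝓡 3) ∞ M] [T2Space M] [CompactSpace M]

/-- Integration by parts for one-forms on a closed three-manifold. -/
theorem integral_wedge_dForm_comm (o : OrientationForm 3 M) (a b : DiffForm 3 M 1) :
    integral o (wedge 3 M 1 2 a (dForm 3 M 1 b)) =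
      integral o (wedge 3 M 1 2 b (dForm 3 M 1 a)) := by
  -- Stokes gives ∫ da ∧ b = ∫ a ∧ db, and the two-form da passes the one-form b without a sign.
  have h := integral_dForm o (wedge 3 M 1 1 a b)
  have h2 := (congrArg (integral o) (dForm_wedge a b)).symm.trans h
  have h3 := (integralₗ o).map_sub (wedge 3 M 2 1 (dForm 3 M 1 a) b)
    (wedge 3 M 1 2 a (dForm 3 M 1 b))
  have h4 := congrArg (integral o) (wedge_comm_two_one (dForm 3 M 1 a) b)
  have h5 := sub_eq_zero.1 (h3.symm.trans h2)
  exact h5.symm.trans h4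

variable {L : Type*} [LieRing L] [LieAlgebra ℝ L]

/-- The pairing `(a, w) ↦ ∫ Tr(a ∧ w)` of one-forms and two-forms. -/
noncomputable def pairOneTwo (o : OrientationForm 3 M) (B : LinearMap.BilinForm ℝ L) :
    ValuedForm 3 M 1 L →ₗ[ℝ] ValuedForm 3 M 2 L →ₗ[ℝ] ℝ :=
  (wedgeWith (k := 1) (l := 2) B).compr₂
    ((integralₗ o).comp (TensorProduct.rid ℝ (DiffForm 3 M 3)).toLinearMap)

/-- The pairing `(w, a) ↦ ∫ Tr(w ∧ a)` of two-forms and one-forms. -/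
noncomputable def pairTwoOne (o : OrientationForm 3 M) (B : LinearMap.BilinForm ℝ L) :
    ValuedForm 3 M 2 L →ₗ[ℝ] ValuedForm 3 M 1 L →ₗ[ℝ] ℝ :=
  (wedgeWith (k := 2) (l := 1) B).compr₂
    ((integralₗ o).comp (TensorProduct.rid ℝ (DiffForm 3 M 3)).toLinearMap)

theorem pairOneTwo_tmul (o : OrientationForm 3 M) (B : LinearMap.BilinForm ℝ L)
    (a : DiffForm 3 M 1) (w : DiffForm 3 M 2) (X Y : L) :
    pairOneTwo o B (a ⊗ₜ X) (w ⊗ₜ Y) = B X Y * integral o (wedge 3 M 1 2 a w) := by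
  refine (congrArg (integralₗ o) (TensorProduct.rid_tmul _ _)).trans ?_
  exact (integralₗ o).map_smul _ _

theorem pairTwoOne_tmul (o : OrientationForm 3 M) (B : LinearMap.BilinForm ℝ L)
    (w : DiffForm 3 M 2) (a : DiffForm 3 M 1) (X Y : L) :
    pairTwoOne o B (w ⊗ₜ X) (a ⊗ₜ Y) = B X Y * integral o (wedge 3 M 2 1 w a) := by
  refine (congrArg (integralₗ o) (TensorProduct.rid_tmul _ _)).trans ?_
  exact (integralₗ o).map_smul _ _

theorem pairTwoOne_comm (o : OrientationForm 3 M) {B : LinearMap.BilinForm ℝ L} (hB : B.IsSymm)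
    (w : ValuedForm 3 M 2 L) (a : ValuedForm 3 M 1 L) :
    pairTwoOne o B w a = pairOneTwo o B a w := by
  induction w using TensorProduct.induction_on with
  | zero => simp
  | add w w' hw hw' => rw [map_add, map_add, LinearMap.add_apply, hw, hw']
  | tmul w X =>
    induction a using TensorProduct.induction_on with
    | zero => simp
    | add a a' ha ha' => rw [map_add, map_add, LinearMap.add_apply, ha, ha']
    | tmul a Y =>
      have h := congrArg (integral o) (wedge_comm_two_one w a)
      have hs : B X Y = B Y X := hB.eq X Y
      rw [pairTwoOne_tmul, pairOneTwo_tmul, hs]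
      exact congrArg _ h

/-- On pure tensors this is integration by parts for the forms and symmetry of B for the
coefficients. -/
theorem pairOneTwo_dValued_comm (o : OrientationForm 3 M) {B : LinearMap.BilinForm ℝ L}
    (hB : B.IsSymm) (a b : ValuedForm 3 M 1 L) :
    pairOneTwo o B a (dValued b) = pairOneTwo o B b (dValued a) := by
  induction a using TensorProduct.induction_on with
  | zero => simp
  | add a a' ha ha' => rw [map_add, map_add, map_add, LinearMap.add_apply, ha, ha']
  | tmul a X =>
    induction b using TensorProduct.induction_on with
    | zero => simp
    | add b b' hb hb' => rw [map_add, map_add, map_add, LinearMap.add_apply, hb, hb']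
    | tmul b Y =>
      have hs : B X Y = B Y X := hB.eq X Y
      have h1 := pairOneTwo_tmul o B a (dForm 3 M 1 b) X Y
      have h2 := pairOneTwo_tmul o B b (dForm 3 M 1 a) Y X
      rw [integral_wedge_dForm_comm, hs] at h1
      exact h1.trans h2.symm

/-- The bracket `(a, b) ↦ [a ∧ b]` of Lie algebra valued one-forms. -/
noncomputable def bracketWedge {n : ℕ} {M : Type*} [TopologicalSpace M]
    [ChartedSpace (EuclideanSpace ℝ (Fin n)) M] [IsManifold (𝓡 n) ∞ M] {L : Type*} [LieRing L]
    [LieAlgebra ℝ L] :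
    ValuedForm n M 1 L →ₗ[ℝ] ValuedForm n M 1 L →ₗ[ℝ] ValuedForm n M 2 L :=
  wedgeWith (k := 1) (l := 1) (LieModule.toEnd ℝ L L : L →ₗ[ℝ] L →ₗ[ℝ] L)

theorem bracketWedge_tmul (a b : DiffForm 3 M 1) (X Y : L) :
    bracketWedge (a ⊗ₜ[ℝ] X) (b ⊗ₜ[ℝ] Y) =
      (show DiffForm 3 M 2 from wedge 3 M 1 1 a b) ⊗ₜ[ℝ] ⁅X, Y⁆ := rfl

/-- The form `(a, b, c) ↦ ∫ Tr([a ∧ b] ∧ c)`. -/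
noncomputable def cubicForm (o : OrientationForm 3 M) (B : LinearMap.BilinForm ℝ L) :
    ValuedForm 3 M 1 L →ₗ[ℝ] ValuedForm 3 M 1 L →ₗ[ℝ] ValuedForm 3 M 1 L →ₗ[ℝ] ℝ :=
  bracketWedge.compr₂ (pairTwoOne o B)

theorem cubicForm_tmul (o : OrientationForm 3 M) (B : LinearMap.BilinForm ℝ L)
    (a b c : DiffForm 3 M 1) (X Y Z : L) :
    cubicForm o B (a ⊗ₜ X) (b ⊗ₜ Y) (c ⊗ₜ Z) =
      B ⁅X, Y⁆ Z * integral o (wedge 3 M 2 1 (wedge 3 M 1 1 a b) c) :=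
  pairTwoOne_tmul o B _ c _ Z

/-- The wedge of one-forms and the Lie bracket are both antisymmetric, so the two signs cancel
already in [a ∧ b]. -/
theorem cubicForm_swap_left (o : OrientationForm 3 M) (B : LinearMap.BilinForm ℝ L)
    (a b c : ValuedForm 3 M 1 L) : cubicForm o B a b c = cubicForm o B b a c := by
  suffices h : cubicForm o B a b = cubicForm o B b a by rw [h]
  refine congrArg (pairTwoOne o B) ?_
  induction a using TensorProduct.induction_on with
  | zero => simp
  | add a a' ha ha' => rw [map_add, map_add, LinearMap.add_apply, ha, ha']
  | tmul a X =>
    induction b using TensorProduct.induction_on with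
    | zero => simp
    | add b b' hb hb' => rw [map_add, map_add, LinearMap.add_apply, hb, hb']
    | tmul b Y =>
      rw [bracketWedge_tmul, bracketWedge_tmul, ← lie_skew, TensorProduct.tmul_neg,
        ← TensorProduct.neg_tmul]
      exact congrArg (· ⊗ₜ[ℝ] ⁅Y, X⁆) (neg_eq_iff_eq_neg.2 (wedge_comm_one_one a b))

/-- Exchanging the last two one-forms gives a sign, and B([X, Y], Z) = −B(Y, [X, Z]) gives another;
symmetry of B restores the order of its arguments. Only here is invariance used directly. -/
theorem cubicForm_swap_right (o : OrientationForm 3 M) {B : LinearMap.BilinForm ℝ L}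
    (hB : B.IsSymm) (hinv : B.lieInvariant L)
    (a b c : ValuedForm 3 M 1 L) : cubicForm o B a b c = cubicForm o B a c b := by
  induction a using TensorProduct.induction_on with
  | zero => simp
  | add a a' ha ha' => simp only [map_add, LinearMap.add_apply, ha, ha']
  | tmul a X =>
    induction b using TensorProduct.induction_on with
    | zero => simp
    | add b b' hb hb' => simp only [map_add, LinearMap.add_apply, hb, hb']
    | tmul b Y =>
      induction c using TensorProduct.induction_on with
      | zero => simp
      | add c c' hc hc' => simp only [map_add, LinearMap.add_apply, hc, hc']
      | tmul c Z =>
        have hs : B ⁅X, Z⁆ Y = B Y ⁅X, Z⁆ := hB.eq _ _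
        have h1 := congrArg (integralₗ o) (wedge_wedge_comm a b c)
        have h2 := h1.trans ((integralₗ o).map_neg _)
        rw [cubicForm_tmul, cubicForm_tmul, hinv, hs, neg_mul, ← mul_neg]
        exact congrArg _ (neg_eq_iff_eq_neg.2 h2)

/-- The coefficient 1/3 is the 2/3 of the action times the 1/2 in A ∧ A = ½[A ∧ A]. -/
theorem csAction_eq (o : OrientationForm 3 M) (B : LinearMap.BilinForm ℝ L)
    (A : Connection 3 M L) :
    csAction o B A = 1 / (4 * Real.pi) *
      (pairOneTwo o B A (dValued A) + 1 / 3 * cubicForm o B A A A) := by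
  have h1 : csAction o B A = 1 / (4 * Real.pi) *
      (pairOneTwo o B A (dValued A) + 2 / 3 * pairTwoOne o B (wedgeSelf A) A) := by
    refine congrArg _ (((integralₗ o).map_add _ _).trans (congrArg _ ?_))
    exact (integralₗ o).map_smul _ _
  have h2 : pairTwoOne o B (wedgeSelf A) A = 1 / 2 * cubicForm o B A A A := by
    have h3 := (pairTwoOne o B).map_smul (1 / 2 : ℝ) (bracketWedge A A)
    exact DFunLike.congr_fun h3 A
  rw [h1, h2]
  ring

theorem curvatureOneForm_eq (o : OrientationForm 3 M) {B : LinearMap.BilinForm ℝ L}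
    (hB : B.IsSymm) (A δA : Connection 3 M L) :
    curvatureOneForm o B A δA =
      pairOneTwo o B δA (dValued A) + 1 / 2 * cubicForm o B A A δA := by
  have h1 : curvatureOneForm o B A δA = pairOneTwo o B δA (dValued A) +
      pairOneTwo o B δA ((1 / 2 : ℝ) • bracketWedge A A) := (pairOneTwo o B δA).map_add _ _
  rw [h1, map_smul, ← pairTwoOne_comm o hB (bracketWedge A A)]
  rfl

theorem hasLineDerivAt_csAction (o : OrientationForm 3 M) {B : LinearMap.BilinForm ℝ L}
    (hB : B.IsSymm) (hinv : B.lieInvariant L) (A δA : Connection 3 M L) :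
    HasLineDerivAt ℝ (csAction o B) (1 / (2 * Real.pi) * curvatureOneForm o B A δA) A δA := by
  set q₀ := pairOneTwo o B A (dValued A)
  set q₁ := pairOneTwo o B δA (dValued A) with hq₁
  set q₂ := pairOneTwo o B δA (dValued δA)
  set t₀ := cubicForm o B A A A
  set t₁ := cubicForm o B A A δA with ht₁
  set t₂ := cubicForm o B A δA δA with ht₂
  set t₃ := cubicForm o B δA δA δA
  -- By symmetry the two mixed quadratic terms coincide, and so do the three cubic terms linear in
  -- δA, which cancels the 1/3. The linear coefficient 2 q₁ + t₁ is twice the pairing of δA with F,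
  -- whence 1/(2π).
  have hpoly : (fun t : ℝ => csAction o B (A + t • δA)) = fun t : ℝ => 1 / (4 * Real.pi) *
      ((q₀ + 1 / 3 * t₀) + (2 * q₁ + t₁) * t + (q₂ + t₂) * t ^ 2 + 1 / 3 * t₃ * t ^ 3) := by
    funext t
    have e1 : pairOneTwo o B A (dValued δA) = q₁ := pairOneTwo_dValued_comm o hB _ _
    have e2 : cubicForm o B A δA A = t₁ := cubicForm_swap_right o hB hinv _ _ _
    have e3 : cubicForm o B δA A A = t₁ := (cubicForm_swap_left o B _ _ _).trans e2
    have e4 : cubicForm o B δA A δA = t₂ := cubicForm_swap_left o B _ _ _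
    have e5 : cubicForm o B δA δA A = t₂ := (cubicForm_swap_right o hB hinv _ _ _).trans e4
    rw [csAction_eq]
    simp only [map_add, map_smul, LinearMap.add_apply, LinearMap.smul_apply, smul_eq_mul, e1, e2,
      e3, e4, e5, ← hq₁, ← ht₁, ← ht₂]
    ring
  have hderiv : HasDerivAt (fun t : ℝ => 1 / (4 * Real.pi) *
      ((q₀ + 1 / 3 * t₀) + (2 * q₁ + t₁) * t + (q₂ + t₂) * t ^ 2 + 1 / 3 * t₃ * t ^ 3))
      (1 / (4 * Real.pi) * (0 + (2 * q₁ + t₁) * 1 + (q₂ + t₂) * (2 * (0 : ℝ) ^ 1) +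
        1 / 3 * t₃ * (3 * (0 : ℝ) ^ 2))) 0 := by
    refine HasDerivAt.const_mul _ (HasDerivAt.add (HasDerivAt.add (HasDerivAt.add
      (hasDerivAt_const _ _) ((hasDerivAt_id _).const_mul _)) (HasDerivAt.const_mul _ ?_))
      (HasDerivAt.const_mul _ ?_))
    · simpa using hasDerivAt_pow 2 (0 : ℝ)
    · simpa using hasDerivAt_pow 3 (0 : ℝ)
  rw [HasLineDerivAt, hpoly, curvatureOneForm_eq o hB]
  refine hderiv.congr_deriv ?_
  ring

theorem hasFirstVariation_csAction (o : OrientationForm 3 M) {B : LinearMap.BilinForm ℝ L}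
    (hB : B.IsSymm) (hinv : B.lieInvariant L) (A : Connection 3 M L) :
    HasFirstVariation (csAction o B)
      (fun δA => 1 / (2 * Real.pi) * curvatureOneForm o B A δA) A :=
  ⟨((1 / (2 * Real.pi)) • (pairOneTwo o B).flip (curvature A)).isLinear,
    hasLineDerivAt_csAction o hB hinv A⟩

end Pairing

/-! ### Construction of test one-forms -/

/-- The coefficients of dxⁱ ∧ α are, up to sign, the three components of α. Quantifying over every β
that acts as the i-th coordinate allows direct application to the differential of a cut-off
coordinate function. -/
theorem ContinuousAlternatingMap.exists_apply_basisFun_ne_zero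
    {α : EuclideanSpace ℝ (Fin 3) [⋀^Fin 2]→L[ℝ] ℝ} (hα : α ≠ 0) :
    ∃ i : Fin 3, ∀ β : EuclideanSpace ℝ (Fin 3) [⋀^Fin 1]→L[ℝ] ℝ, (∀ v, β (fun _ => v) = v i) →
      (altWedge β α : EuclideanSpace ℝ (Fin 3) [⋀^Fin 3]→L[ℝ] ℝ)
        (EuclideanSpace.basisFun (Fin 3) ℝ) ≠ 0 := by
  by_contra! hcon
  set e := EuclideanSpace.basisFun (Fin 3) ℝ with he
  have hval : ∀ i : Fin 3, (if i = 0 then α ![e 1, e 2] else if i = 1 then - α ![e 0, e 2] else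
      α ![e 0, e 1]) = 0 := by
    intro i
    obtain ⟨β, hβ, h0⟩ := hcon i
    rw [← h0]
    refine Eq.trans ?_ (altWedge_one_two_apply β α e).symm
    fin_cases i <;> simp [hβ, he]
  have h12 : α ![e 1, e 2] = 0 := by simpa using hval 0
  have h02 : α ![e 0, e 2] = 0 := by simpa using hval 1
  have h01 : α ![e 0, e 1] = 0 := by simpa using hval 2
  have h21 : α ![e 2, e 1] = 0 := by rw [α.map_swap_two, h12, neg_zero]
  have h20 : α ![e 2, e 0] = 0 := by rw [α.map_swap_two, h02, neg_zero]
  have h10 : α ![e 1, e 0] = 0 := by rw [α.map_swap_two, h01, neg_zero]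
  refine hα (ContinuousAlternatingMap.toAlternatingMap_injective
    (Module.Basis.ext_alternating e.toBasis fun v hv => ?_))
  have hv' : v 0 ≠ v 1 := fun h => by simpa using hv h
  have key : ∀ i j : Fin 3, i ≠ j → α ![e i, e j] = 0 := by
    intro i j hij
    fin_cases i <;> fin_cases j <;> first | exact absurd rfl hij | assumption
  refine Eq.trans ?_ (key _ _ hv')
  refine congrArg α (funext fun i => ?_)
  fin_cases i <;> simp

section ZeroForms
variable {n : ℕ} {M : Type*} [TopologicalSpace M] [ChartedSpace (EuclideanSpace ℝ (Fin n)) M]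
  [IsManifold (𝓡 n) ∞ M]

/-- A smooth function as a zero-form. -/
noncomputable def zeroForm (u : M → ℝ) (hu : ContMDiff (𝓡 n) 𝓘(ℝ, ℝ) ∞ u) : DiffForm n M 0 :=
  ⟨fun x => ContinuousAlternatingMap.constOfIsEmpty ℝ _ (Fin 0) (u x), fun c =>
    ((ContinuousAlternatingMap.constOfIsEmptyLIE ℝ (EuclideanSpace ℝ (Fin n)) ℝ
      (Fin 0)).contDiff.comp_contDiffOn (contDiffOn_comp_chart_symm hu c)).congr fun _ _ => rfl⟩

theorem localRep_dForm_zeroForm (u : M → ℝ) (hu : ContMDiff (𝓡 n) 𝓘(ℝ, ℝ) ∞ u) (c : M)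
    {y : EuclideanSpace ℝ (Fin n)} (hy : y ∈ (chartAt (EuclideanSpace ℝ (Fin n)) c).target)
    (v : EuclideanSpace ℝ (Fin n)) :
    localRep (dForm n M 0 (zeroForm u hu)).1 c y (fun _ => v) =
      fderiv ℝ (fun z => u ((chartAt (EuclideanSpace ℝ (Fin n)) c).symm z)) y v := by
  have h := extDeriv_constOfIsEmpty (𝕜 := ℝ)
    (fun z => u ((chartAt (EuclideanSpace ℝ (Fin n)) c).symm z)) y
  have h2 := (localRep_rawExtDeriv (zeroForm u hu).2 c hy).trans h
  exact DFunLike.congr_fun h2 _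

end ZeroForms

/-! ### Nondegeneracy of the integration pairing, and stationary points -/

section Nondegenerate
variable {M : Type*} [TopologicalSpace M] [ChartedSpace (EuclideanSpace ℝ (Fin 3)) M]
  [IsManifold (𝓡 3) ∞ M] [T2Space M] [CompactSpace M]

/-- The integration pairing of one-forms and two-forms is nondegenerate. -/
theorem eq_zero_of_forall_integral_wedge_eq_zero (o : OrientationForm 3 M) (η : DiffForm 3 M 2)
    (h : ∀ ζ : DiffForm 3 M 1, integral o (wedge 3 M 1 2 ζ η) = 0) : η = 0 := by
  refine DiffForm.ext_apply fun p => ?_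
  change η.1 p = 0
  by_contra hp
  set e := chartAt (EuclideanSpace ℝ (Fin 3)) p with he
  have hpe : e p ∈ e.target := mem_chart_target _ p
  have hsp : e.symm (e p) = p := e.left_inv (mem_chart_source _ p)
  have hloc : localRep η.1 p (e p) ≠ 0 := fun h0 => by
    have := eq_zero_of_localRep_eq_zero p hpe h0
    rw [← he, hsp] at this
    exact hp this
  obtain ⟨i, hi⟩ := ContinuousAlternatingMap.exists_apply_basisFun_ne_zero hloc
  obtain ⟨b⟩ : Nonempty (SmoothBumpFunction (𝓡 3) p) := inferInstance
  have hchart : ContMDiffOn (𝓡 3) 𝓘(ℝ, EuclideanSpace ℝ (Fin 3)) ∞ e e.source :=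
    contMDiffOn_chart
  have hcoord : ContMDiffOn (𝓡 3) 𝓘(ℝ, ℝ) ∞ (fun x => e x i) e.source :=
    ((EuclideanSpace.proj (𝕜 := ℝ) i).contDiff.contMDiff.comp_contMDiffOn hchart)
  -- The bump function makes the i-th coordinate a global smooth function. It equals 1 near p, so du
  -- is dxⁱ at p and du ∧ η does not vanish there.
  set u : M → ℝ := fun x => b x • e x i with hu_def
  have hu : ContMDiff (𝓡 3) 𝓘(ℝ, ℝ) ∞ u := b.contMDiff_smul hcoord
  set du := dForm 3 M 0 (zeroForm u hu) with hdu
  set H : DiffForm 3 M 3 := wedge 3 M 1 2 du η with hH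
  have hdu_p : ∀ v, localRep du.1 p (e p) (fun _ => v) = v i := by
    intro v
    refine (localRep_dForm_zeroForm u hu p hpe v).trans ?_
    have hev : (fun z => u (e.symm z)) =ᶠ[nhds (e p)] EuclideanSpace.proj (𝕜 := ℝ) i := by
      have hb : ∀ᶠ z in nhds (e p), b (e.symm z) = 1 := by
        have hc : Filter.Tendsto e.symm (nhds (e p)) (nhds p) := by
          have := (e.continuousAt_symm hpe).tendsto
          rwa [hsp] at this
        exact hc.eventually b.eventuallyEq_one
      filter_upwards [hb, e.open_target.mem_nhds hpe] with z hz hzt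
      simp [hu_def, hz, e.right_inv hzt]
    rw [hev.fderiv_eq, ContinuousLinearMap.fderiv]
    rfl
  have hHp : topCoeff H p (e p) ≠ 0 := by
    have h1 := hi (localRep du.1 p (e p)) hdu_p
    have h2 := altWedge_comp (du.1 (e.symm (e p))) (η.1 (e.symm (e p))) (chartPush p (e p))
    intro h3
    exact h1 ((DFunLike.congr_fun h2 _).symm.trans h3)
  have hprod : ContMDiffOn (𝓡 3) 𝓘(ℝ, ℝ) ∞
      (fun x => topCoeff o.form p (e x) * topCoeff H p (e x)) e.source :=
    (((contDiffOn_topCoeff o.form p).mul (contDiffOn_topCoeff H p)).contMDiffOn).comp hchart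
      fun x hx => e.map_source hx
  -- Write ω and h for the coefficients of the orientation form and of H = du ∧ η. Testing with f du
  -- gives the integrand sign(ω) · (b ω h) · h = b |ω| h² ≥ 0: the factor ω absorbs the orientation
  -- sign smoothly, and the factor h makes a square.
  set f : M → ℝ := fun x => b x • (topCoeff o.form p (e x) * topCoeff H p (e x)) with hf_def
  have hf : ContMDiff (𝓡 3) 𝓘(ℝ, ℝ) ∞ f := b.contMDiff_smul hprod
  have hwedge : (wedge 3 M 1 2 (funSMul f hf du) η : DiffForm 3 M 3) = funSMul f hf H :=
    DiffForm.ext_apply fun x => (altWedgeₗ _ 1 2).map_smul₂ (f x) (du.1 x) (η.1 x)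
  have hzero : ∀ x ∉ tsupport b, (funSMul f hf H).1 x = 0 := by
    intro x hx
    change (b x • _) • H.1 x = 0
    rw [image_eq_zero_of_notMem_tsupport hx, zero_smul, zero_smul]
  have hzero' : ∀ y ∈ e.target, e.symm y ∉ tsupport b → topCoeff (funSMul f hf H) p y = 0 :=
    fun y _ hy => topCoeff_eq_zero p (hzero _ hy)
  have hint := h (funSMul f hf du)
  have hint' := (congrArg (integral o) hwedge).symm.trans hint
  rw [integral_eq_setIntegral o _ p (isClosed_tsupport b) b.tsupport_subset_chartAt_source hzero,
    setIntegral_sign_mul_eq] at hint'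
  have hval : ∀ y ∈ e.target, signExtend o p (topCoeff (funSMul f hf H) p) y =
      b (e.symm y) * (|topCoeff o.form p y| * topCoeff H p y ^ 2) := by
    intro y hy
    rw [signExtend, indicator_of_mem hy, topCoeff_funSMul, ← Real.sign_mul_self_eq_abs, ← he]
    simp only [hf_def, e.right_inv hy, smul_eq_mul]
    ring
  -- A continuous, compactly supported, nonnegative function that is nonzero at the image of p has
  -- positive integral, contradicting the hypothesis.
  refine hint'.not_gt ?_
  refine (contDiff_signExtend o p (isClosed_tsupport b) b.tsupport_subset_chartAt_source hzero'
    (contDiffOn_topCoeff _ p)).continuous.integral_pos_of_hasCompactSupport_nonneg_nonzero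
    (hasCompactSupport_signExtend o p (isClosed_tsupport b) b.tsupport_subset_chartAt_source hzero')
    (fun y => ?_) (x := e p) ?_
  · by_cases hy : y ∈ e.target
    · rw [Pi.zero_apply, hval y hy]
      exact mul_nonneg b.nonneg (by positivity)
    · exact (indicator_of_notMem hy _).ge
  · rw [hval _ hpe, hsp, b.eq_one, one_mul]
    exact mul_ne_zero (abs_ne_zero.2 (topCoeff_ne_zero o p hpe)) (pow_ne_zero 2 hHp)

variable {L : Type*} [LieRing L] [LieAlgebra ℝ L]

theorem eq_zero_of_forall_pairOneTwo_eq_zero [FiniteDimensional ℝ L] (o : OrientationForm 3 M)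
    {B : LinearMap.BilinForm ℝ L} (hB : B.Nondegenerate) (w : ValuedForm 3 M 2 L)
    (h : ∀ a, pairOneTwo o B a w = 0) : w = 0 := by
  classical
  set b := Module.finBasis ℝ L
  obtain ⟨c, rfl⟩ := TensorProduct.eq_repr_basis_right b w
  suffices hc : c = 0 by simp [hc]
  ext1 j
  refine eq_zero_of_forall_integral_wedge_eq_zero o _ fun ζ => ?_
  -- With w = ∑ cᵢ ⊗ bᵢ, pairing against the dual basis vector isolates ∫ ζ ∧ cⱼ.
  have h1 := h (ζ ⊗ₜ B.dualBasis hB b j)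
  rw [Finsupp.sum, map_sum] at h1
  simp only [pairOneTwo_tmul, LinearMap.BilinForm.apply_dualBasis_left, ite_mul, one_mul,
    zero_mul] at h1
  rw [Finset.sum_ite_eq' ] at h1
  split_ifs at h1 with hj
  · exact h1
  · rw [Finsupp.notMem_support_iff.1 hj, map_zero]
    exact (integralₗ o).map_zero

theorem isStationaryPoint_csAction_iff_isFlat [FiniteDimensional ℝ L] (o : OrientationForm 3 M)
    {B : LinearMap.BilinForm ℝ L} (hB : B.IsSymm) (hinv : B.lieInvariant L)
    (hnd : B.Nondegenerate) (A : Connection 3 M L) :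
    IsStationaryPoint (csAction o B) A ↔ IsFlat A := by
  constructor
  · rintro ⟨-, hA⟩
    refine eq_zero_of_forall_pairOneTwo_eq_zero o hnd _ fun a => ?_
    -- Line derivatives are unique, so 1/(2π) ∫ Tr(a ∧ F) is zero for every a.
    have h1 := (hasLineDerivAt_csAction o hB hinv A a).unique (hA a)
    exact (mul_eq_zero.1 h1).resolve_left (by positivity)
  · intro hA
    refine ⟨(0 : Connection 3 M L →ₗ[ℝ] ℝ).isLinear, fun a => ?_⟩
    have h1 := hasLineDerivAt_csAction o hB hinv A a
    have h2 : curvatureOneForm o B A a = 0 :=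
      (congrArg (pairOneTwo o B a) hA).trans (map_zero _)
    rwa [h2, mul_zero] at h1

end Nondegenerate

/-- Stationary = flat. The first variation of the Chern-Simons action on a closed oriented
three-manifold is `1/(2π)` times the curvature, regarded as a one-form on the space of connections;
if the invariant form `B` is nondegenerate, its stationary points are exactly the flat
connections. -/
theorem lemma2p1
    {EG : Type*} [NormedAddCommGroup EG] [NormedSpace ℝ EG] [FiniteDimensional ℝ EG]
    {G : Type*} [Group G] [TopologicalSpace G] [ChartedSpace EG G] [LieGroup 𝓘(ℝ, EG) ∞ G]
    {M : Type*} [TopologicalSpace M] [T2Space M] [CompactSpace M]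
    [ChartedSpace (EuclideanSpace ℝ (Fin 3)) M] [IsManifold (𝓡 3) ∞ M]
    (o : OrientationForm 3 M)
    (B : LinearMap.BilinForm ℝ (GroupLieAlgebra 𝓘(ℝ, EG) G))
    (hsymm : B.IsSymm) (hinv : B.lieInvariant (GroupLieAlgebra 𝓘(ℝ, EG) G)) :
    (∀ A : Connection 3 M (GroupLieAlgebra 𝓘(ℝ, EG) G),
      HasFirstVariation (csAction o B)
        (fun δA => 1 / (2 * Real.pi) * curvatureOneForm o B A δA) A) ∧
    (B.Nondegenerate → ∀ A : Connection 3 M (GroupLieAlgebra 𝓘(ℝ, EG) G),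
      IsStationaryPoint (csAction o B) A ↔ IsFlat A) := by
  -- The Lie algebra is the tangent space at the identity, which unfolds to the model space `EG`.
  have : FiniteDimensional ℝ (GroupLieAlgebra 𝓘(ℝ, EG) G) :=
    inferInstanceAs (FiniteDimensional ℝ EG)
  exact ⟨fun A => hasFirstVariation_csAction o hsymm hinv A,
    fun hnd A => isStationaryPoint_csAction_iff_isFlat o hsymm hinv hnd A⟩
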